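/- **Setting.** Let $\Lambda=\mathbb{C}[p_1,p_2,\dots]$, graded by giving $p_k$ weight $k$, with $\Lambda_n$ the part of weight $n$. For a linear operator $G$ on $\Lambda$ preserving every $\Lambda_n$, put $$\{G\}_q=\frac{\sum_{n\ge0}q^n\,\mathrm{tr}_{\Lambda_n}G}{\sum_{n\ge0}q^n\dim\Lambda_n}\in\mathbb{C}[[q]].$$ For a constant $c\in\mathbb{C}$ let $P_k$ ($k\in\mathbb{Z}$) be the operator on $\Lambda$ given by multiplication by $p_k$ if $k\ge1$, multiplication by $c$ if $k=0$, and $-k\,\partial/\partial p_{-k}$ if $k\le-1$. For $g\in\mathbb{Q}[\mathbf{u}]=\mathbb{Q}[u_0,u_1,u_2,\dots]$, let $\overline g(c)$ be the operator on $\Lambda$ obtained as follows: form the power series $\int_0^{2\pi}g(v_0(x),v_1(x),\dots)\frac{dx}{2\pi}$ in variables $\omega_k$ ($k\in\mathbb{Z}$), where $v_j(x)=\sum_{k\in\mathbb{Z}}(\mathrm{i}k)^j\omega_k e^{\mathrm{i}kx}$ (with $0^0=1$); in each monomial write the $\omega_k$ with $k\ge0$ to the left of those with $k<0$; and replace each $\omega_k$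 by $P_k$. Let $M\subset\mathbb{Q}[[q]]$ be the space of finite sums of $q$-expansions of modular forms (of any weights) on $\mathrm{SL}_2(\mathbb{Z})$ with rational Fourier coefficients, let $\mathbb{G}_2=-\frac1{24}+\sum_{m,r\ge1}m\,q^{mr}$, and let $\widetilde M=M[\mathbb{G}_2]$ be the ring of quasimodular forms with rational coefficients. **Proposition.** There is a unique $\mathbb{Q}$-linear derivation $\mathfrak{d}$ of $\widetilde M$ which vanishes on $M$ and satisfies $\mathfrak{d}(\mathbb{G}_2)=-\frac12$. For every $g\in\mathbb{Q}[\mathbf{u}]$, the series $\{\overline g(c)\}_q$ is a polynomial in $c$ with coefficients in $\widetilde M$, and, with $\mathfrak{d}$ acting on the coefficients, $$-2\,\mathfrak{d}\,\{\overline g(c)\}_q=\frac{\partial^2}{\partial c^2}\{\overline g(c)\}_q=\Bigl\{\overline{\tfrac{\partial^2g}{\partial u_0^2}}(c)\Bigr\}_q .$$ Consequently $\{\overline g(0)\}_q$ is modular (that is, lies in $M$) if and only if $\bigl\{\overline{\partial^2g/\partial u_0^2}(0)\bigr\}_q=0$. -/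

import Mathlib

open scoped MatrixGroups

noncomputable section

namespace QuantumKdV

/-! ### The Fock space and its operators -/

/-- `Λ ⊗ ℂ = ℂ[p₁, p₂, …]`. (The operators `ḡ` may have non-real coefficients.) -/
abbrev Fock : Type := MvPolynomial ℕ+ ℂ

/-- `Λ_n ⊗ ℂ`: the homogeneous polynomials of weight `n`, where `p_k` has weight `k`. -/
abbrev FockGrade (n : ℕ) : Submodule ℂ Fock :=
  MvPolynomial.weightedHomogeneousSubmodule ℂ (fun k : ℕ+ => (k : ℕ)) n

/-- The operator `P_k`, `k ∈ ℤ`: multiplication by `p_k` for `k ≥ 1`, multiplication by the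
constant `c` for `k = 0`, and `-k ∂/∂p_{-k}` for `k ≤ -1`. -/
def opP (c : ℂ) : ℤ → Module.End ℂ Fock
  | Int.ofNat 0 => c • LinearMap.id
  | Int.ofNat (n + 1) => LinearMap.mulLeft ℂ (MvPolynomial.X n.succPNat)
  | Int.negSucc n => ((n : ℂ) + 1) • (MvPolynomial.pderiv n.succPNat).toLinearMap

/-- The operator obtained from the monomial `∏ ω_k ^ (m k)` by normal ordering and replacing each
`ω_k` by `P_k`: the factors are written from left to right in order of decreasing `k`. In
particular those with `k ≥ 0` stand to the left of those with `k < 0`; the order within either of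
these two groups is immaterial, as the operators in it commute. -/
def normalOrdered (c : ℂ) (m : ℤ →₀ ℕ) : Module.End ℂ Fock :=
  ((m.support.sort (· ≥ ·)).map (fun k => opP c k ^ m k)).prod

/-! ### Quantization of differential polynomials -/

/-- The Fourier series `v_j(x) = ∑_{k ∈ ℤ} (i k)^j ω_k e^{i k x}` (with `0 ^ 0 = 1`), as a formal
power series in the variables `ω_k`, `k ∈ ℤ`, whose coefficients are trigonometric polynomials
in `x`, i.e. Laurent polynomials in `T = e^{i x}`. -/
def fourierV (j : ℕ) : MvPowerSeries ℤ (LaurentPolynomial ℂ) := by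
  classical
  exact fun m => ∑ k ∈ m.support, if m = Finsupp.single k 1
    then ((Complex.I * (k : ℂ)) ^ j) • LaurentPolynomial.T k else 0

/-- The coefficient of the monomial `∏ ω_k ^ (m k)` in `∫₀^{2π} g(v(x)) dx / 2π`. The mean of a
Laurent polynomial in `e^{i x}` over a period is its constant coefficient. -/
def meanCoeff (g : MvPolynomial ℕ ℚ) (m : ℤ →₀ ℕ) : ℂ :=
  (MvPowerSeries.coeff m (MvPolynomial.aeval fourierV g)).coeff 0

/-- The operator `ḡ(c)`, given by its values on the basis of monomials in the `p_k`. The power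
series `∫₀^{2π} g(v(x)) dx / 2π` has infinitely many terms in general, but only finitely many of
the resulting operators do not kill a given element of `Λ`. -/
def quantize (c : ℂ) (g : MvPolynomial ℕ ℚ) : Module.End ℂ Fock :=
  (MvPolynomial.basisMonomials ℕ+ ℂ).constr ℂ fun s =>
    ∑ᶠ m : ℤ →₀ ℕ, meanCoeff g m • normalOrdered c m (MvPolynomial.monomial s 1)

/-! ### The `q`-series attached to an operator -/

/-- The component `Λ_n → Λ_n` of an operator `G` on `Λ`. It is the restriction of `G` to `Λ_n`
when `G` preserves `Λ_n`, see `gradeBlock_eq_restrict`. -/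
def gradeBlock (G : Module.End ℂ Fock) (n : ℕ) : Module.End ℂ (FockGrade n) :=
  ((MvPolynomial.weightedHomogeneousComponent (fun k : ℕ+ => (k : ℕ)) n).codRestrict (FockGrade n)
    (fun f => MvPolynomial.weightedHomogeneousComponent_mem _ f n)) ∘ₗ G ∘ₗ (FockGrade n).subtype

theorem gradeBlock_eq_restrict (G : Module.End ℂ Fock) (n : ℕ)
    (hG : ∀ f ∈ FockGrade n, G f ∈ FockGrade n) : gradeBlock G n = G.restrict hG := by
  ext1 f
  apply Subtype.ext
  exact MvPolynomial.weightedHomogeneousComponent_eq_self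
    ((MvPolynomial.mem_weightedHomogeneousSubmodule _ _ _ _).1 (hG f f.2))

/-- `{G}_q = (∑ qⁿ tr_{Λ_n} G) / (∑ qⁿ dim Λ_n)`, as a formal power series in `q`. -/
def qBracket (G : Module.End ℂ Fock) : PowerSeries ℂ :=
  PowerSeries.mk (fun n => LinearMap.trace ℂ (FockGrade n) (gradeBlock G n)) *
    (PowerSeries.mk fun n => (Module.finrank ℂ (FockGrade n) : ℂ))⁻¹

/-! ### Modular and quasimodular forms for the full modular group, with rational coefficients -/

/-- The space of modular forms (of mixed weight) on `SL₂(ℤ)` with rational Fourier coefficients,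
given by their `q`-expansions: the finite sums of modular forms of pure weights. -/
def modularForms : Submodule ℚ (PowerSeries ℂ) :=
  Submodule.span ℚ {φ | ∃ (k : ℤ) (f : ModularForm 𝒮ℒ k),
    φ = UpperHalfPlane.qExpansion 1 f ∧ ∀ n, ∃ r : ℚ, PowerSeries.coeff n φ = (r : ℂ)}

/-- `𝔾₂ = -1/24 + ∑_{m, r ≥ 1} m q^{m r}`. -/
def eisensteinG2 : PowerSeries ℂ :=
  PowerSeries.mk fun n => if n = 0 then -1 / 24 else (ArithmeticFunction.sigma 1 n : ℂ)

/-- The ring `M̃ = M[𝔾₂]` of quasimodular forms (of mixed weight) on `SL₂(ℤ)` with rational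
Fourier coefficients, given by their `q`-expansions. -/
def quasimodularForms : Subalgebra ℚ (PowerSeries ℂ) :=
  Algebra.adjoin ℚ ((modularForms : Set (PowerSeries ℂ)) ∪ {eisensteinG2})

/-- `𝔾₂` as an element of the ring of quasimodular forms. -/
def quasiG2 : quasimodularForms :=
  ⟨eisensteinG2, Algebra.subset_adjoin (Or.inr rfl)⟩

/-- The derivation `𝔡` of the ring of quasimodular forms vanishes on modular forms and maps
`𝔾₂` to `-1/2`. -/
def IsAnomalyDerivation (D : Derivation ℚ quasimodularForms quasimodularForms) : Prop :=
  (∀ x : quasimodularForms, (x : PowerSeries ℂ) ∈ modularForms → D x = 0) ∧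
    D quasiG2 = algebraMap ℚ quasimodularForms (-1 / 2)

/-- The value at `c` of a polynomial with quasimodular coefficients. -/
def evalAt (c : ℂ) (F : Polynomial quasimodularForms) : PowerSeries ℂ :=
  F.eval₂ (algebraMap quasimodularForms (PowerSeries ℂ)) (PowerSeries.C c)

end QuantumKdV

end

noncomputable section

namespace QuantumKdV

/-! ### Commutation relations -/

/-! Write ⟨f⟩ for the `q`-bracket of the normally ordered operator with symbol f. For k ≠ 0, P_k
shifts the weight by k, so moving it cyclically around the trace costs a power of q. Moving it back
through the normally ordered operator costs only the commutator, which is a derivative of the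
symbol. Comparing the two gives ⟨f ω_k⟩ = |k| q^|k| / (1 - q^|k|) · ⟨∂f/∂ω_{-k}⟩, while ω_0
contributes the factor c.

Summing over k with the weights (ik)^j gives the Wick recursion (`quantizeBracket_mul_X`) ⟨g u_j⟩ =
δ_{j0} c ⟨g⟩ + ∑_l S_{jl} ⟨∂g/∂u_l⟩, where S_{jl} is a multiple of ∑ σ_{j+l+1}(n) qⁿ. It vanishes
for j + l odd and is modular for j + l > 0 even; only S_{00} = 2𝔾₂ + 1/12 is not modular, and 𝔡
S_{00} = -1 (`exists_quasimodular_propagator`). By induction on the degree of g, the bracket is a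
polynomial in c over the quasimodular forms. The operations -2𝔡, ∂²/∂c² and g ↦ ∂²g/∂u_0² all turn
the recursion into the same one, with extra term 2 δ_{j0} ⟨∂g/∂u_0⟩, so they agree
(`IsBracketPolynomial.mul_X`).

That 𝔡 exists and has kernel exactly M rests on 𝔾₂ being transcendental over M
(`transcendental_eisensteinG2`), so that M[𝔾₂] is a polynomial ring and 𝔡 = -1/2 d/d𝔾₂. The infinite
sum defining ḡ(c) is handled by truncation: on Λ_n only the modes |k| ≤ n matter. -/

theorem opP_zero (c : ℂ) : opP c 0 = c • 1 := rfl

theorem opP_natCast_pos (c : ℂ) (k : ℕ+) :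
    opP c (k : ℕ) = LinearMap.mulLeft ℂ (MvPolynomial.X k) := by
  obtain ⟨n, rfl⟩ : ∃ n : ℕ, n.succPNat = k := ⟨k.natPred, by simp⟩
  rfl

theorem opP_neg_natCast_pos (c : ℂ) (k : ℕ+) :
    opP c (-(k : ℕ)) = (k : ℂ) • (MvPolynomial.pderiv k).toLinearMap := by
  obtain ⟨n, rfl⟩ : ∃ n : ℕ, n.succPNat = k := ⟨k.natPred, by simp⟩
  have : (-((n.succPNat : ℕ) : ℤ)) = Int.negSucc n := by simp [Int.negSucc_eq]
  rw [this]
  simp [opP]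

theorem exists_pnat_of_pos {k : ℤ} (hk : 0 < k) : ∃ n : ℕ+, k = (n : ℕ) :=
  ⟨⟨k.toNat, by omega⟩, by simp; omega⟩

theorem exists_pnat_of_neg {k : ℤ} (hk : k < 0) : ∃ n : ℕ+, k = -(n : ℕ) :=
  ⟨⟨(-k).toNat, by omega⟩, by simp; omega⟩

theorem opP_commute_of_nonneg (c : ℂ) {j k : ℤ} (hj : 0 ≤ j) (hk : 0 ≤ k) :
    Commute (opP c j) (opP c k) := by
  rcases hj.eq_or_lt with rfl | hj
  · exact (Commute.one_left _).smul_left c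
  rcases hk.eq_or_lt with rfl | hk
  · exact (Commute.one_right _).smul_right c
  obtain ⟨a, rfl⟩ := exists_pnat_of_pos hj
  obtain ⟨b, rfl⟩ := exists_pnat_of_pos hk
  rw [opP_natCast_pos, opP_natCast_pos]
  refine LinearMap.ext fun f => ?_
  simp [mul_left_comm]

theorem pderiv_pderiv_comm {σ R : Type*} [CommSemiring R] (i j : σ) (f : MvPolynomial σ R) :
    MvPolynomial.pderiv i (MvPolynomial.pderiv j f) =
      MvPolynomial.pderiv j (MvPolynomial.pderiv i f) := by
  classical
  induction f using MvPolynomial.induction_on with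
  | C a => simp
  | add p q hp hq => simp [hp, hq]
  | mul_X p n h =>
    simp only [MvPolynomial.pderiv_mul, map_add, MvPolynomial.pderiv_X, h]
    simp only [Pi.single_apply]
    split_ifs <;> simp <;> ring

theorem opP_commute_of_neg (c : ℂ) {j k : ℤ} (hj : j < 0) (hk : k < 0) :
    Commute (opP c j) (opP c k) := by
  obtain ⟨a, rfl⟩ := exists_pnat_of_neg hj
  obtain ⟨b, rfl⟩ := exists_pnat_of_neg hk
  rw [opP_neg_natCast_pos, opP_neg_natCast_pos]
  refine ((?_ : Commute _ _).smul_left _).smul_right _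
  exact LinearMap.ext fun f => pderiv_pderiv_comm a b f

theorem opP_neg_mul_opP_nonneg (c : ℂ) {j k : ℤ} (hj : j < 0) (hk : 0 ≤ k) :
    opP c j * opP c k = opP c k * opP c j + (if j = -k then (k : ℂ) else 0) • 1 := by
  classical
  rcases hk.eq_or_lt with rfl | hk
  · simp [opP_zero]
  obtain ⟨a, rfl⟩ := exists_pnat_of_neg hj
  obtain ⟨b, rfl⟩ := exists_pnat_of_pos hk
  rw [opP_neg_natCast_pos, opP_natCast_pos]
  refine LinearMap.ext fun f => ?_
  by_cases h : a = b
  · subst h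
    simp [add_comm, smul_add]
  · have h' : ¬ ((a : ℕ) : ℤ) = (b : ℕ) := by exact_mod_cast h
    simp [MvPolynomial.pderiv_X, h', Ne.symm h]

/-! ### Normal ordering -/

/-- In a decreasing list the factors to the left of position k have larger index, and `p` commutes
with all of them, so it can be pulled out in front. For normal ordering this is the case k ≥ 0; the
mirror statement below serves k < 0. -/
theorem list_prod_map_eq_mul {M : Type*} [Monoid M] (f g : ℤ → M) (p : M) (k : ℤ)
    (hk : f k = p * g k) (hne : ∀ j, j ≠ k → f j = g j) (hc : ∀ j, k < j → Commute (g j) p) :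
    ∀ l : List ℤ, l.SortedGT → k ∈ l → (l.map f).prod = p * (l.map g).prod
  | [], _, h => by simp at h
  | a :: l, hl, h => by
    have hl' := List.pairwise_cons.1 hl.pairwise
    by_cases hak : a = k
    · subst hak
      have : l.map f = l.map g := List.map_congr_left fun j hj => hne j (hl'.1 j hj).ne
      simp [hk, this, mul_assoc]
    · have hkl : k ∈ l := by simpa [Ne.symm hak] using h
      have hka : k < a := hl'.1 k hkl
      simp only [List.map_cons, List.prod_cons]
      rw [list_prod_map_eq_mul f g p k hk hne hc l hl'.2.sortedGT hkl, hne a hak, ← mul_assoc,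
        (hc a hka).eq, mul_assoc]

theorem list_prod_map_eq_mul_right {M : Type*} [Monoid M] (f g : ℤ → M) (p : M) (k : ℤ)
    (hk : f k = g k * p) (hne : ∀ j, j ≠ k → f j = g j) (hc : ∀ j, j < k → Commute (g j) p) :
    ∀ l : List ℤ, l.SortedGT → k ∈ l → (l.map f).prod = (l.map g).prod * p
  | [], _, h => by simp at h
  | a :: l, hl, h => by
    have hl' := List.pairwise_cons.1 hl.pairwise
    by_cases hak : a = k
    · subst hak
      have h1 : l.map f = l.map g := List.map_congr_left fun j hj => hne j (hl'.1 j hj).ne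
      have h2 : Commute (l.map g).prod p := by
        refine Commute.list_prod_left _ _ fun x hx => ?_
        obtain ⟨j, hj, rfl⟩ := List.mem_map.1 hx
        exact hc j (hl'.1 j hj)
      simp [hk, h1, mul_assoc, h2.eq]
    · have hkl : k ∈ l := by simpa [Ne.symm hak] using h
      simp only [List.map_cons, List.prod_cons]
      rw [list_prod_map_eq_mul_right f g p k hk hne hc l hl'.2.sortedGT hkl, hne a hak, mul_assoc]

theorem list_prod_map_filter_eq {M : Type*} [Monoid M] (f : ℤ → M) (p : ℤ → Prop)
    [DecidablePred p] (hp : ∀ j, ¬ p j → f j = 1) (l : List ℤ) :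
    ((l.filter p).map f).prod = (l.map f).prod := by
  induction l with
  | nil => simp
  | cons a l ih =>
    by_cases h : p a
    · simp [h, ih]
    · simp [h, ih, hp a h]

/-- Indices outside the support only contribute factors P_k^0 = 1. This lets two monomials with
different supports be compared along one common list. -/
theorem normalOrdered_eq_of_subset (c : ℂ) (m : ℤ →₀ ℕ) (s : Finset ℤ) (hs : m.support ⊆ s) :
    normalOrdered c m = ((s.sort (· ≥ ·)).map (fun k => opP c k ^ m k)).prod := by
  classical
  rw [← list_prod_map_filter_eq _ (· ∈ m.support) (by intro j hj; simp_all), normalOrdered]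
  congr 2
  refine List.Perm.eq_of_pairwise (le := (· ≥ ·)) (fun a b _ _ h1 h2 => le_antisymm h2 h1)
    (Finset.pairwise_sort _ _) ((Finset.pairwise_sort _ _).filter _) ?_
  refine (List.perm_ext_iff_of_nodup (Finset.sort_nodup _ _)
    ((Finset.sort_nodup _ _).filter _)).2 fun a => ?_
  simp only [Finset.mem_sort, List.mem_filter, decide_eq_true_eq]
  exact ⟨fun h => ⟨hs h, h⟩, fun h => h.2⟩

theorem normalOrdered_add_single_of_nonneg (c : ℂ) (m : ℤ →₀ ℕ) {k : ℤ} (hk : 0 ≤ k) :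
    normalOrdered c (m + Finsupp.single k 1) = opP c k * normalOrdered c m := by
  classical
  have h1 : (m + Finsupp.single k 1).support ⊆ insert k m.support := by
    intro j hj
    by_contra h
    simp only [Finset.mem_insert, not_or, Finsupp.mem_support_iff, not_not] at h
    simp [h.2, Ne.symm h.1] at hj
  rw [normalOrdered_eq_of_subset c _ _ h1,
    normalOrdered_eq_of_subset c m _ (Finset.subset_insert k m.support)]
  refine list_prod_map_eq_mul _ _ _ k ?_ ?_ ?_ _ (Finset.sortedGT_sort _) (by simp)
  · simp [pow_succ']
  · intro j hj
    simp [Ne.symm hj]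
  · intro j hj
    exact (opP_commute_of_nonneg c (by omega) hk).pow_left _

theorem normalOrdered_add_single_of_neg (c : ℂ) (m : ℤ →₀ ℕ) {k : ℤ} (hk : k < 0) :
    normalOrdered c (m + Finsupp.single k 1) = normalOrdered c m * opP c k := by
  classical
  have h1 : (m + Finsupp.single k 1).support ⊆ insert k m.support := by
    intro j hj
    by_contra h
    simp only [Finset.mem_insert, not_or, Finsupp.mem_support_iff, not_not] at h
    simp [h.2, Ne.symm h.1] at hj
  rw [normalOrdered_eq_of_subset c _ _ h1,
    normalOrdered_eq_of_subset c m _ (Finset.subset_insert k m.support)]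
  refine list_prod_map_eq_mul_right _ _ _ k ?_ ?_ ?_ _ (Finset.sortedGT_sort _) (by simp)
  · simp [pow_succ]
  · intro j hj
    simp [Ne.symm hj]
  · intro j hj
    exact (opP_commute_of_neg c (by omega) hk).pow_left _

/-- Normal ordering of polynomials in the `ω_k`, followed by replacing each `ω_k` by `P_k`. -/
def normalOrder (c : ℂ) : MvPolynomial ℤ ℂ →ₗ[ℂ] Module.End ℂ Fock :=
  (MvPolynomial.basisMonomials ℤ ℂ).constr ℂ (normalOrdered c)

theorem normalOrder_monomial (c : ℂ) (m : ℤ →₀ ℕ) (a : ℂ) :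
    normalOrder c (MvPolynomial.monomial m a) = a • normalOrdered c m := by
  have h : MvPolynomial.monomial m a = a • MvPolynomial.basisMonomials ℤ ℂ m := by
    simp [MvPolynomial.smul_monomial]
  rw [h, map_smul, normalOrder, Module.Basis.constr_basis]

theorem normalOrder_one (c : ℂ) : normalOrder c 1 = 1 := by
  rw [← MvPolynomial.C_1, ← MvPolynomial.monomial_zero', normalOrder_monomial]
  simp [normalOrdered]

theorem normalOrder_mul_X_of_nonneg (c : ℂ) (f : MvPolynomial ℤ ℂ) {k : ℤ} (hk : 0 ≤ k) :
    normalOrder c (f * MvPolynomial.X k) = opP c k * normalOrder c f := by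
  induction f using MvPolynomial.induction_on' with
  | monomial m a =>
    rw [MvPolynomial.X, MvPolynomial.monomial_mul, normalOrder_monomial, normalOrder_monomial,
      normalOrdered_add_single_of_nonneg c m hk]
    simp
  | add p q hp hq => rw [add_mul, map_add, hp, hq, map_add, mul_add]

theorem normalOrder_mul_X_of_neg (c : ℂ) (f : MvPolynomial ℤ ℂ) {k : ℤ} (hk : k < 0) :
    normalOrder c (f * MvPolynomial.X k) = normalOrder c f * opP c k := by
  induction f using MvPolynomial.induction_on' with
  | monomial m a =>
    rw [MvPolynomial.X, MvPolynomial.monomial_mul, normalOrder_monomial, normalOrder_monomial,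
      normalOrdered_add_single_of_neg c m hk]
    simp
  | add p q hp hq => rw [add_mul, map_add, hp, hq, map_add, add_mul]

/-- Among the P_j, only P_{-k} can fail to commute with P_k, and their commutator is a scalar; hence
the commutator with P_k acts on symbols as a multiple of the derivation ∂/∂ω_{-k}. -/
theorem normalOrder_mul_opP (c : ℂ) (f : MvPolynomial ℤ ℂ) {k : ℤ} (hk : 0 ≤ k) :
    normalOrder c f * opP c k =
      opP c k * normalOrder c f + (k : ℂ) • normalOrder c (MvPolynomial.pderiv (-k) f) := by
  classical
  induction f using MvPolynomial.induction_on with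
  | C a =>
    rw [← mul_one (MvPolynomial.C a), ← MvPolynomial.smul_eq_C_mul]
    simp [normalOrder_one]
  | add p q hp hq =>
    simp only [map_add, add_mul, mul_add, smul_add, hp, hq]
    abel
  | mul_X p j h =>
    rw [MvPolynomial.pderiv_mul, map_add]
    by_cases hj : 0 ≤ j
    · rw [normalOrder_mul_X_of_nonneg c p hj, normalOrder_mul_X_of_nonneg c _ hj, mul_assoc, h,
        mul_add, ← mul_assoc, ← mul_assoc, (opP_commute_of_nonneg c hj hk).eq]
      congr 1
      -- With j and k both nonnegative this forces k = 0, and the derivative term then has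
      -- coefficient 0.
      by_cases h0 : j = -k
      · have hk0 : k = 0 := by omega
        simp [hk0]
      · simp [MvPolynomial.pderiv_X_of_ne h0]
    · have hj : j < 0 := by omega
      rw [normalOrder_mul_X_of_neg c p hj, normalOrder_mul_X_of_neg c _ hj, mul_assoc,
        opP_neg_mul_opP_nonneg c hj hk, mul_add, ← mul_assoc, h, add_mul, smul_add, add_assoc,
        mul_assoc]
      congr 1
      by_cases h0 : j = -k
      · subst h0
        simp
      · simp [MvPolynomial.pderiv_X_of_ne h0, h0]

theorem opP_mul_normalOrder (c : ℂ) (f : MvPolynomial ℤ ℂ) {k : ℤ} (hk : k < 0) :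
    opP c k * normalOrder c f =
      normalOrder c f * opP c k + (-k : ℂ) • normalOrder c (MvPolynomial.pderiv (-k) f) := by
  classical
  induction f using MvPolynomial.induction_on with
  | C a =>
    rw [← mul_one (MvPolynomial.C a), ← MvPolynomial.smul_eq_C_mul]
    simp [normalOrder_one]
  | add p q hp hq =>
    simp only [map_add, add_mul, mul_add, smul_add, hp, hq]
    abel
  | mul_X p j h =>
    rw [MvPolynomial.pderiv_mul, map_add]
    by_cases hj : 0 ≤ j
    · rw [normalOrder_mul_X_of_nonneg c p hj, normalOrder_mul_X_of_nonneg c _ hj, ← mul_assoc,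
        opP_neg_mul_opP_nonneg c hk hj, add_mul, mul_assoc, h, mul_add, smul_add, mul_assoc,
        add_assoc]
      congr 1
      by_cases h0 : j = -k
      · subst h0
        simp
      · have h1 : ¬ k = -j := by omega
        simp [MvPolynomial.pderiv_X_of_ne h0, h1]
    · have hj : j < 0 := by omega
      have h0 : j ≠ -k := by omega
      rw [normalOrder_mul_X_of_neg c p hj, normalOrder_mul_X_of_neg c _ hj, ← mul_assoc, h,
        add_mul, mul_assoc, (opP_commute_of_neg c hk hj).eq, mul_assoc]
      rw [MvPolynomial.pderiv_X_of_ne h0, mul_zero, map_zero, add_zero, smul_mul_assoc]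

/-! ### Graded traces -/

/-- The weight of a monomial in the `p_k`. -/
abbrev fockWeight : (ℕ+ →₀ ℕ) →+ ℕ := Finsupp.weight (fun k : ℕ+ => (k : ℕ))

theorem finite_fockWeight_eq (n : ℕ) : {s | fockWeight s = n}.Finite := by
  classical
  refine (Set.finite_Iic (∑ k ∈ Finset.Icc 1 n.succPNat, Finsupp.single k n)).subset
    fun s hs k => ?_
  have h1 : s k ≤ n := (Finsupp.le_weight _ k.ne_zero s).trans_eq hs
  rw [Finsupp.finsetSum_apply]
  by_cases hk : s k = 0
  · simp [hk]
  · have h2 : (k : ℕ) ≤ n := by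
      rw [← show fockWeight s = n from hs]
      exact Finsupp.le_weight_of_ne_zero' _ hk
    have h3 : k ∈ Finset.Icc 1 n.succPNat := by
      simp only [Finset.mem_Icc, one_le, true_and]
      rw [← PNat.coe_le_coe]
      simp; omega
    refine h1.trans ?_
    rw [Finset.sum_eq_single_of_mem k h3 (fun b _ hb => by simp [hb])]
    simp

/-- The monomials of weight `n`. -/
def partitionsOf (n : ℕ) : Finset (ℕ+ →₀ ℕ) := (finite_fockWeight_eq n).toFinset

theorem mem_partitionsOf {n : ℕ} {s : ℕ+ →₀ ℕ} : s ∈ partitionsOf n ↔ fockWeight s = n := by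
  simp [partitionsOf]

theorem fockGrade_eq_restrictSupport (n : ℕ) :
    MvPolynomial.restrictSupport ℂ {s | fockWeight s = n} = FockGrade n :=
  (MvPolynomial.weightedHomogeneousSubmodule_eq_finsupp_supported ℂ _ n).symm

/-- The basis of `Λ_n` consisting of the monomials of weight `n`. -/
def fockGradeBasis (n : ℕ) : Module.Basis {s | fockWeight s = n} ℂ (FockGrade n) :=
  (MvPolynomial.basisRestrictSupport ℂ {s | fockWeight s = n}).map
    (LinearEquiv.ofEq _ _ (fockGrade_eq_restrictSupport n))

theorem fockGradeBasis_repr_apply (n : ℕ) (f : FockGrade n) (s : {s | fockWeight s = n}) :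
    (fockGradeBasis n).repr f s = MvPolynomial.coeff s.1 (f : Fock) := rfl

theorem coe_fockGradeBasis (n : ℕ) (s : {s | fockWeight s = n}) :
    ((fockGradeBasis n s : FockGrade n) : Fock) = MvPolynomial.monomial s.1 1 := by
  have h : fockGradeBasis n s =
      ⟨MvPolynomial.monomial s.1 1, MvPolynomial.isWeightedHomogeneous_monomial _ _ _ s.2⟩ := by
    classical
    refine (fockGradeBasis n).ext_elem fun t => ?_
    rw [Module.Basis.repr_self, fockGradeBasis_repr_apply]
    simp [Finsupp.single_apply, MvPolynomial.coeff_monomial, Subtype.ext_iff]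
  rw [h]

theorem trace_gradeBlock (G : Module.End ℂ Fock) (n : ℕ) :
    LinearMap.trace ℂ (FockGrade n) (gradeBlock G n) =
      ∑ s ∈ partitionsOf n, MvPolynomial.coeff s (G (MvPolynomial.monomial s 1)) := by
  classical
  have : Fintype {s | fockWeight s = n} := (finite_fockWeight_eq n).fintype
  rw [LinearMap.trace_eq_matrix_trace ℂ (fockGradeBasis n), Matrix.trace]
  have h1 : ∀ s : {s | fockWeight s = n}, Matrix.diag (LinearMap.toMatrix (fockGradeBasis n)
      (fockGradeBasis n) (gradeBlock G n)) s =
      MvPolynomial.coeff s.1 (G (MvPolynomial.monomial s.1 1)) := by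
    intro s
    rw [Matrix.diag_apply, LinearMap.toMatrix_apply, fockGradeBasis_repr_apply]
    simp only [gradeBlock, LinearMap.comp_apply, Submodule.subtype_apply, coe_fockGradeBasis,
      LinearMap.codRestrict_apply, MvPolynomial.coeff_weightedHomogeneousComponent]
    exact if_pos s.2
  simp only [h1]
  exact (Finset.sum_subtype (partitionsOf n) (fun s => mem_partitionsOf)
    (fun s => MvPolynomial.coeff s (G (MvPolynomial.monomial s 1)))).symm

/-- The generating series of the traces of the components of an operator. -/
def traceSeries : Module.End ℂ Fock →ₗ[ℂ] PowerSeries ℂ where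
  toFun G := PowerSeries.mk fun n => LinearMap.trace ℂ (FockGrade n) (gradeBlock G n)
  map_add' G H := by
    ext n
    simp [trace_gradeBlock, Finset.sum_add_distrib]
  map_smul' a G := by
    ext n
    simp [trace_gradeBlock, Finset.mul_sum]

theorem coeff_traceSeries (G : Module.End ℂ Fock) (n : ℕ) :
    PowerSeries.coeff n (traceSeries G) =
      ∑ s ∈ partitionsOf n, MvPolynomial.coeff s (G (MvPolynomial.monomial s 1)) := by
  rw [← trace_gradeBlock]
  simp [traceSeries]

/-- Cyclicity of the trace: P_k maps Λ_n to Λ_{n+k}, whence the shift by q^k. Only diagonal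
coefficients enter, so `A` need not respect the grading; the bijection s ↦ s + e_k onto the
monomials divisible by p_k matches the two sums. -/
theorem traceSeries_opP_mul (c : ℂ) (k : ℕ+) (A : Module.End ℂ Fock) :
    traceSeries (opP c (k : ℕ) * A) =
      PowerSeries.X ^ (k : ℕ) * traceSeries (A * opP c (k : ℕ)) := by
  classical
  ext n
  rw [PowerSeries.coeff_X_pow_mul', coeff_traceSeries]
  have h1 : ∀ s : ℕ+ →₀ ℕ, MvPolynomial.coeff s ((opP c (k : ℕ) * A) (MvPolynomial.monomial s 1)) =
      if s k ≠ 0 then MvPolynomial.coeff (s - Finsupp.single k 1)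
        (A (MvPolynomial.monomial s 1)) else 0 := by
    intro s
    rw [Module.End.mul_apply, opP_natCast_pos, LinearMap.mulLeft_apply, MvPolynomial.coeff_X_mul']
    simp
  simp only [h1]
  rw [← Finset.sum_filter]
  split_ifs with hk
  · rw [coeff_traceSeries]
    symm
    refine Finset.sum_bij (fun s _ => s + Finsupp.single k 1) ?_ ?_ ?_ ?_
    · intro s hs
      rw [mem_partitionsOf] at hs
      simp [mem_partitionsOf, hs, Finsupp.weight_single]
      omega
    · intro a _ b _ h
      exact add_right_cancel h
    · intro s hs
      simp only [Finset.mem_filter, mem_partitionsOf] at hs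
      have h2 : s - Finsupp.single k 1 + Finsupp.single k 1 = s := by
        refine tsub_add_cancel_of_le ?_
        simp; omega
      refine ⟨s - Finsupp.single k 1, ?_, h2⟩
      have h3 := congrArg fockWeight h2
      rw [map_add, hs.1, Finsupp.weight_single] at h3
      rw [mem_partitionsOf]
      simp at h3
      omega
    · intro s _
      rw [Module.End.mul_apply, opP_natCast_pos, LinearMap.mulLeft_apply, MvPolynomial.X,
        MvPolynomial.monomial_mul, add_comm s]
      simp
  · refine Finset.sum_eq_zero fun s hs => ?_
    simp only [Finset.mem_filter, mem_partitionsOf] at hs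
    have := Finsupp.le_weight_of_ne_zero' (fun k : ℕ+ => (k : ℕ)) hs.2
    exact absurd (this.trans_eq hs.1) hk

theorem traceSeries_mul_opP_neg (c : ℂ) (k : ℕ+) (A : Module.End ℂ Fock) :
    traceSeries (A * opP c (-(k : ℕ))) =
      PowerSeries.X ^ (k : ℕ) * traceSeries (opP c (-(k : ℕ)) * A) := by
  classical
  ext n
  rw [PowerSeries.coeff_X_pow_mul', coeff_traceSeries]
  have h1 : ∀ s : ℕ+ →₀ ℕ,
      MvPolynomial.coeff s ((A * opP c (-(k : ℕ))) (MvPolynomial.monomial s 1)) =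
      if s k ≠ 0 then (k : ℂ) * s k * MvPolynomial.coeff s
        (A (MvPolynomial.monomial (s - Finsupp.single k 1) 1)) else 0 := by
    intro s
    rw [Module.End.mul_apply, opP_neg_natCast_pos, LinearMap.smul_apply,
      show (MvPolynomial.pderiv k).toLinearMap _ = MvPolynomial.pderiv k _ from rfl,
        MvPolynomial.pderiv_monomial, one_mul]
    have : (MvPolynomial.monomial (s - Finsupp.single k 1) (s k : ℂ) : Fock) =
        (s k : ℂ) • MvPolynomial.monomial (s - Finsupp.single k 1) 1 := by
      simp [MvPolynomial.smul_monomial]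
    rw [this]
    by_cases h0 : s k = 0
    · simp [h0]
    · simp [h0, mul_assoc]
  simp only [h1]
  rw [← Finset.sum_filter]
  split_ifs with hk
  · rw [coeff_traceSeries]
    symm
    refine Finset.sum_bij (fun s _ => s + Finsupp.single k 1) ?_ ?_ ?_ ?_
    · intro s hs
      rw [mem_partitionsOf] at hs
      simp [mem_partitionsOf, hs, Finsupp.weight_single]
      omega
    · intro a _ b _ h
      exact add_right_cancel h
    · intro s hs
      simp only [Finset.mem_filter, mem_partitionsOf] at hs
      have h2 : s - Finsupp.single k 1 + Finsupp.single k 1 = s := by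
        refine tsub_add_cancel_of_le ?_
        simp; omega
      refine ⟨s - Finsupp.single k 1, ?_, h2⟩
      have h3 := congrArg fockWeight h2
      rw [map_add, hs.1, Finsupp.weight_single] at h3
      rw [mem_partitionsOf]
      simp at h3
      omega
    · intro s _
      rw [Module.End.mul_apply, opP_neg_natCast_pos, LinearMap.smul_apply,
        show (MvPolynomial.pderiv k).toLinearMap _ = MvPolynomial.pderiv k _ from rfl,
        MvPolynomial.coeff_smul,
        MvPolynomial.coeff_pderiv]
      simp
      ring
  · refine Finset.sum_eq_zero fun s hs => ?_
    simp only [Finset.mem_filter, mem_partitionsOf] at hs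
    have := Finsupp.le_weight_of_ne_zero' (fun k : ℕ+ => (k : ℕ)) hs.2
    exact absurd (this.trans_eq hs.1) hk

/-- Cyclicity and the commutator formula give two relations between the traces of both orderings;
eliminating the wrongly ordered one leaves the contraction of ω_k with ω_{-k}. -/
theorem traceSeries_normalOrder_mul_X (c : ℂ) (f : MvPolynomial ℤ ℂ) {k : ℤ} (hk : k ≠ 0) :
    (1 - PowerSeries.X ^ k.natAbs) * traceSeries (normalOrder c (f * MvPolynomial.X k)) =
      (k.natAbs : PowerSeries ℂ) * PowerSeries.X ^ k.natAbs *
        traceSeries (normalOrder c (MvPolynomial.pderiv (-k) f)) := by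
  rcases lt_or_gt_of_ne hk with h | h
  · obtain ⟨n, rfl⟩ := exists_pnat_of_neg h
    have h1 := traceSeries_mul_opP_neg c n (normalOrder c f)
    rw [opP_mul_normalOrder c f h, ← normalOrder_mul_X_of_neg c f h, map_add, map_smul,
      PowerSeries.smul_eq_C_mul] at h1
    simp only [Int.natAbs_neg, Int.natAbs_natCast]
    simp only [Int.cast_neg, neg_neg, Int.cast_natCast, map_natCast] at h1 ⊢
    linear_combination h1
  · obtain ⟨n, rfl⟩ := exists_pnat_of_pos h
    have h1 := traceSeries_opP_mul c n (normalOrder c f)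
    rw [normalOrder_mul_opP c f h.le, ← normalOrder_mul_X_of_nonneg c f h.le, map_add, map_smul,
      PowerSeries.smul_eq_C_mul] at h1
    simp only [Int.natAbs_natCast]
    simp only [Int.cast_natCast, map_natCast] at h1 ⊢
    linear_combination h1

theorem traceSeries_normalOrder_mul_X_zero (c : ℂ) (f : MvPolynomial ℤ ℂ) :
    traceSeries (normalOrder c (f * MvPolynomial.X 0)) =
      PowerSeries.C c * traceSeries (normalOrder c f) := by
  rw [normalOrder_mul_X_of_nonneg c f le_rfl, opP_zero, smul_mul_assoc, one_mul, map_smul,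
    PowerSeries.smul_eq_C_mul]

theorem qBracket_eq (G : Module.End ℂ Fock) :
    qBracket G = traceSeries G * (traceSeries 1)⁻¹ := by
  unfold qBracket
  congr 2
  ext n
  have h : gradeBlock 1 n = 1 := by
    rw [gradeBlock_eq_restrict 1 n (fun f hf => hf)]
    rfl
  have : Module.Finite ℂ (FockGrade n) := by
    have : Finite {s | fockWeight s = n} := finite_fockWeight_eq n
    exact Module.Finite.of_basis (fockGradeBasis n)
  simp [traceSeries, h]

theorem constantCoeff_traceSeries_one : PowerSeries.constantCoeff (traceSeries 1) = 1 := by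
  classical
  rw [← PowerSeries.coeff_zero_eq_constantCoeff_apply, coeff_traceSeries]
  have : partitionsOf 0 = {0} := by
    ext s
    rw [mem_partitionsOf, Finset.mem_singleton]
    refine ⟨fun h => ?_, fun h => by simp [h]⟩
    ext k
    have := Finsupp.le_weight (fun k : ℕ+ => (k : ℕ)) k.ne_zero s
    simp only [fockWeight] at h
    simp; omega
  simp [this]

theorem qBracket_one : qBracket 1 = 1 := by
  rw [qBracket_eq]
  exact PowerSeries.mul_inv_cancel _ (by simp [constantCoeff_traceSeries_one])

section ModularForms

open UpperHalfPlane ModularForm EisensteinSeries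

/-! ### The ring of modular forms -/

/-- A power series with rational coefficients. -/
def HasRatCoeffs (φ : PowerSeries ℂ) : Prop := ∀ n, ∃ r : ℚ, PowerSeries.coeff n φ = (r : ℂ)

theorem rat_smul_eq_C_mul (r : ℚ) (φ : PowerSeries ℂ) : r • φ = PowerSeries.C (r : ℂ) * φ := by
  ext n
  rw [map_rat_smul (PowerSeries.coeff n), PowerSeries.coeff_C_mul, Rat.smul_def]

theorem HasRatCoeffs.mul {φ ψ : PowerSeries ℂ} (h : HasRatCoeffs φ) (h' : HasRatCoeffs ψ) :
    HasRatCoeffs (φ * ψ) := by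
  choose a ha using h
  choose b hb using h'
  refine fun n => ⟨∑ p ∈ Finset.HasAntidiagonal.antidiagonal n, a p.1 * b p.2, ?_⟩
  rw [PowerSeries.coeff_mul]
  push_cast
  exact Finset.sum_congr rfl fun p _ => by rw [ha, hb]

theorem qExpansion_mem_modularForms {k : ℤ} (f : ModularForm 𝒮ℒ k)
    (hf : HasRatCoeffs (qExpansion 1 f)) : qExpansion 1 f ∈ modularForms :=
  Submodule.subset_span ⟨k, f, rfl, hf⟩

theorem one_mem_modularForms : (1 : PowerSeries ℂ) ∈ modularForms := by
  rw [← ModularForm.qExpansion_one (Γ := 𝒮ℒ) (h := 1)]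
  refine qExpansion_mem_modularForms _ fun n => ⟨if n = 0 then 1 else 0, ?_⟩
  rw [ModularForm.qExpansion_one, PowerSeries.coeff_one]
  split_ifs <;> simp

theorem mul_mem_modularForms {φ ψ : PowerSeries ℂ} (hφ : φ ∈ modularForms)
    (hψ : ψ ∈ modularForms) : φ * ψ ∈ modularForms := by
  have h : φ * ψ ∈ modularForms * modularForms := Submodule.mul_mem_mul hφ hψ
  rw [modularForms, Submodule.span_mul_span] at h
  refine Submodule.span_mono ?_ h
  rintro _ ⟨_, ⟨k, f, rfl, hf⟩, _, ⟨l, g, rfl, hg⟩, rfl⟩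
  refine ⟨k + l, f.mul g, ?_, HasRatCoeffs.mul hf hg⟩
  exact (ModularForm.qExpansion_mul one_pos one_mem_strictPeriods_SL f g).symm

/-- The ring of modular forms. -/
def modularSubalgebra : Subalgebra ℚ (PowerSeries ℂ) :=
  modularForms.toSubalgebra one_mem_modularForms fun _ _ => mul_mem_modularForms

/-! ### Convergent `q`-series -/

/-- The power series `φ` converges absolutely at each `q = e^{2πiτ}`, with sum `F τ`. -/
def HasValue (φ : PowerSeries ℂ) (F : ℍ → ℂ) : Prop :=
  ∀ τ : ℍ, HasSum (fun n => PowerSeries.coeff n φ * Function.Periodic.qParam 1 τ ^ n) (F τ)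

theorem HasValue.add {φ ψ : PowerSeries ℂ} {F G : ℍ → ℂ} (h : HasValue φ F) (h' : HasValue ψ G) :
    HasValue (φ + ψ) (F + G) := fun τ => by
  simpa [add_mul] using (h τ).add (h' τ)

theorem HasValue.mul {φ ψ : PowerSeries ℂ} {F G : ℍ → ℂ} (h : HasValue φ F) (h' : HasValue ψ G) :
    HasValue (φ * ψ) (F * G) := fun τ => by
  have h1 := summable_norm_sum_mul_antidiagonal_of_summable_norm (h τ).summable.norm
    (h' τ).summable.norm
  have h2 := tsum_mul_tsum_eq_tsum_sum_antidiagonal_of_summable_norm (h τ).summable.norm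
    (h' τ).summable.norm
  rw [(h τ).tsum_eq, (h' τ).tsum_eq] at h2
  rw [Pi.mul_apply, h2]
  have h3 : (fun n => PowerSeries.coeff n (φ * ψ) * Function.Periodic.qParam 1 τ ^ n) =
      fun n => ∑ p ∈ Finset.HasAntidiagonal.antidiagonal n,
        PowerSeries.coeff p.1 φ * Function.Periodic.qParam 1 τ ^ p.1 *
          (PowerSeries.coeff p.2 ψ * Function.Periodic.qParam 1 τ ^ p.2) := by
    funext n
    rw [PowerSeries.coeff_mul, Finset.sum_mul]
    refine Finset.sum_congr rfl fun p hp => ?_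
    rw [← Finset.HasAntidiagonal.mem_antidiagonal.1 hp, pow_add]
    ring
  rw [h3]
  exact h1.of_norm.hasSum

theorem hasValue_C (a : ℂ) : HasValue (PowerSeries.C a) fun _ => a := fun τ => by
  convert hasSum_ite_eq 0 a using 2 with n
  rw [PowerSeries.coeff_C]
  split_ifs with h <;> simp [h]

theorem HasValue.pow {φ : PowerSeries ℂ} {F : ℍ → ℂ} (h : HasValue φ F) (n : ℕ) :
    HasValue (φ ^ n) (F ^ n) := by
  induction n with
  | zero => rw [pow_zero, ← map_one PowerSeries.C]; exact hasValue_C 1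
  | succ n ih => simpa only [pow_succ] using ih.mul h

theorem HasValue.sum {ι : Type*} {s : Finset ι} {φ : ι → PowerSeries ℂ} {F : ι → ℍ → ℂ}
    (h : ∀ i ∈ s, HasValue (φ i) (F i)) : HasValue (∑ i ∈ s, φ i) (∑ i ∈ s, F i) := by
  classical
  induction s using Finset.induction_on with
  | empty => rw [Finset.sum_empty, ← map_zero PowerSeries.C]; exact hasValue_C 0
  | insert a s ha ih =>
    rw [Finset.sum_insert ha, Finset.sum_insert ha]
    exact (h a (by simp)).add (ih fun i hi => h i (by simp [hi]))

theorem HasValue.unique {φ : PowerSeries ℂ} {F G : ℍ → ℂ} (h : HasValue φ F) (h' : HasValue φ G) :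
    F = G :=
  funext fun τ => (h τ).unique (h' τ)

theorem hasValue_qExpansion {k : ℤ} (f : ModularForm 𝒮ℒ k) : HasValue (qExpansion 1 f) f :=
  fun τ => by
    have : Fact (IsCusp OnePoint.infty 𝒮ℒ) :=
      ⟨Subgroup.isCusp_of_mem_strictPeriods one_pos one_mem_strictPeriods_SL⟩
    exact ModularForm.hasSum_qExpansion f one_pos one_mem_strictPeriods_SL τ

theorem hasValue_eisensteinG2 : HasValue eisensteinG2 fun τ => -1 / 24 * E2 τ := fun τ => by
  convert! (hasSum_qExpansion_E2 τ).mul_left (-1 / 24 : ℂ) using 2 with n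
  rw [eisensteinG2, PowerSeries.coeff_mk]
  by_cases h : n = 0
  · simp [h]
  · simp only [h, if_false, smul_eq_mul, Function.Periodic.qParam, Complex.ofReal_one, div_one]
    ring

/-! ### Transformation laws and the transcendence of 𝔾₂ over modular forms. -/

theorem modularForm_smul {k : ℤ} (f : ModularForm 𝒮ℒ k) (γ : SL(2, ℤ)) (τ : ℍ) :
    f (γ • τ) = ((γ 1 0 : ℂ) * τ + γ 1 1) ^ k * f τ := by
  have h : (⇑f : ℍ → ℂ) ∣[k] γ = ⇑f := SlashInvariantForm.slash_action_eqn f _ ⟨γ, rfl⟩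
  have h2 := congrFun h τ
  have hd := denom_ne_zero γ τ
  rw [SL_slash_apply] at h2
  rw [ModularGroup.denom_apply] at h2 hd
  rw [← h2, mul_comm, mul_assoc, ← zpow_add₀ hd]
  simp

theorem E2_smul (γ : SL(2, ℤ)) (τ : ℍ) :
    -1 / 24 * E2 (γ • τ) = ((γ 1 0 : ℂ) * τ + γ 1 1) ^ 2 * (-1 / 24 * E2 τ) +
      Complex.I / (4 * Real.pi) * (γ 1 0 : ℂ) * ((γ 1 0 : ℂ) * τ + γ 1 1) := by
  have h := congrFun (E2_slash_action γ) τ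
  have hd := denom_ne_zero γ τ
  have hpi : (Real.pi : ℂ) ≠ 0 := by exact_mod_cast Real.pi_ne_zero
  rw [SL_slash_apply] at h
  simp only [D2, riemannZeta_two, Pi.sub_apply, Pi.smul_apply, smul_eq_mul] at h
  rw [ModularGroup.denom_apply] at h hd
  generalize E2 (γ • τ) = x at *
  generalize E2 τ = y at *
  generalize (γ 1 0 : ℂ) * τ + γ 1 1 = d at *
  have h2 : x = d ^ 2 * (y - 1 / (2 * (Real.pi ^ 2 / 6)) * (2 * Real.pi * Complex.I * γ 1 0 / d)) := by
    rw [← h]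
    field_simp
  rw [h2]
  field_simp
  ring

theorem hasValue_qExpansionRingHom (F : DirectSum ℤ fun k => ModularForm 𝒮ℒ k)
    (K : Finset ℤ) (hK : ∀ k ∉ K, F k = 0) :
    HasValue (qExpansionRingHom 1 one_pos one_mem_strictPeriods_SL F) (∑ k ∈ K, ⇑(F k)) := by
  classical
  have h : ∑ k ∈ K, DirectSum.of (fun k => ModularForm 𝒮ℒ k) k (F k) = F := by
    rw [← Finset.sum_subset (s₁ := DFinsupp.support F), DirectSum.sum_support_of]
    · intro k hk
      by_contra hne
      exact DFinsupp.mem_support_iff.1 hk (hK k hne)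
    · intro k _ hk
      rw [DFinsupp.notMem_support_iff.1 hk, map_zero]
  rw [← h, map_sum, h]
  refine HasValue.sum fun k _ => ?_
  rw [qExpansionRingHom_apply]
  exact hasValue_qExpansion _

theorem exists_qExpansionRingHom_eq {φ : PowerSeries ℂ} (hφ : φ ∈ modularForms) :
    ∃ F, qExpansionRingHom (Γ := 𝒮ℒ) 1 one_pos one_mem_strictPeriods_SL F = φ := by
  induction hφ using Submodule.span_induction with
  | mem x hx =>
    obtain ⟨k, f, rfl, -⟩ := hx
    exact ⟨_, qExpansionRingHom_apply one_pos one_mem_strictPeriods_SL k f⟩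
  | zero => exact ⟨0, map_zero _⟩
  | add x y _ _ hx hy =>
    obtain ⟨F, rfl⟩ := hx
    obtain ⟨G, rfl⟩ := hy
    exact ⟨F + G, map_add _ _ _⟩
  | smul r x _ hx =>
    obtain ⟨F, rfl⟩ := hx
    refine ⟨DirectSum.of (fun k => ModularForm 𝒮ℒ k) 0 ((r : ℂ) • 1) * F, ?_⟩
    rw [map_mul, qExpansionRingHom_apply]
    have h : qExpansion 1 (⇑((r : ℂ) • (1 : ModularForm 𝒮ℒ 0))) = PowerSeries.C (r : ℂ) := by
      have h1 := ModularForm.qExpansion_smul one_pos one_mem_strictPeriods_SL (r : ℂ)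
        (1 : ModularForm 𝒮ℒ 0)
      rw [ModularForm.qExpansion_one, PowerSeries.smul_eq_C_mul, mul_one] at h1
      exact h1
    rw [h, rat_smul_eq_C_mul]

/-- The pairs (c, 1 + c t) are bottom rows of matrices in SL₂(ℤ). For fixed c ≠ 0 the automorphy
factor takes infinitely many values as t varies, so it may be replaced by a free variable y; then c
takes infinitely many values and may be replaced by a free variable z. As κ ≠ 0, the quantity e y +
κ z is independent of y, and comparing coefficients finishes the proof. -/
theorem coeff_eq_zero_of_forall_sum_eq_zero {N : ℕ} {K : Finset ℤ} {a : ℕ → ℤ → ℂ} {e κ τ : ℂ}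
    (hκ : κ ≠ 0) (hτ : τ.im ≠ 0)
    (h : ∀ c t : ℤ, ∑ i ∈ Finset.range N, ∑ k ∈ K, a i k * (c * τ + (1 + c * t)) ^ k *
      ((c * τ + (1 + c * t)) ^ 2 * e + κ * c * (c * τ + (1 + c * t))) ^ i = 0) :
    ∀ i < N, ∀ k ∈ K, a i k = 0 := by
  classical
  obtain ⟨B, hB⟩ : ∃ B : ℕ, ∀ k ∈ K, 0 ≤ k + B := by
    refine ⟨∑ k ∈ K, k.natAbs, fun k hk => ?_⟩
    have := Finset.single_le_sum (f := Int.natAbs) (fun _ _ => Nat.zero_le _) hk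
    omega
  set w : ℤ → ℕ := fun k => (k + B).toNat with hw
  have h1 : ∀ c t : ℤ, c ≠ 0 → ∑ i ∈ Finset.range N, ∑ k ∈ K,
      a i k * (c * τ + (1 + c * t)) ^ (w k + i) * (e * (c * τ + (1 + c * t)) + κ * c) ^ i = 0 := by
    intro c t hc
    have hd : (c * τ + (1 + c * t) : ℂ) ≠ 0 := by
      intro h0
      have := congrArg Complex.im h0
      simp [hc, hτ] at this
    have h2 := congrArg (fun x => x * (c * τ + (1 + c * t) : ℂ) ^ B) (h c t)
    simp only [Finset.sum_mul, zero_mul] at h2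
    rw [← h2]
    refine Finset.sum_congr rfl fun i _ => Finset.sum_congr rfl fun k hk => ?_
    generalize (c * τ + (1 + c * t) : ℂ) = d at *
    have h3 : d ^ w k = d ^ k * d ^ B := by
      rw [← zpow_natCast, ← zpow_natCast d B, ← zpow_add₀ hd]
      congr 1
      simp only [hw]
      exact Int.toNat_of_nonneg (hB k hk)
    rw [pow_add, h3, show d ^ 2 * e + κ * c * d = d * (e * d + κ * c) by ring, mul_pow]
    ring
  have h2 : ∀ c : ℤ, c ≠ 0 → ∀ y : ℂ, ∑ i ∈ Finset.range N, ∑ k ∈ K,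
      a i k * y ^ (w k + i) * (e * y + κ * c) ^ i = 0 := by
    intro c hc
    have hc' : (c : ℂ) ≠ 0 := by exact_mod_cast hc
    set Q : Polynomial ℂ := ∑ i ∈ Finset.range N, ∑ k ∈ K, Polynomial.C (a i k) *
      Polynomial.X ^ (w k + i) *
      (Polynomial.C e * Polynomial.X + Polynomial.C (κ * c)) ^ i with hQ
    have hev : ∀ y, Q.eval y = ∑ i ∈ Finset.range N, ∑ k ∈ K,
        a i k * y ^ (w k + i) * (e * y + κ * c) ^ i := by
      intro y
      simp [hQ, Polynomial.eval_finsetSum]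
    have h0 : Q = 0 := by
      refine Polynomial.eq_zero_of_infinite_isRoot Q ?_
      refine (Set.infinite_range_of_injective
        (f := fun t : ℤ => (c * τ + (1 + c * t) : ℂ)) ?_).mono ?_
      · intro s t hst
        simpa [hc'] using hst
      · rintro _ ⟨t, rfl⟩
        exact (hev _).trans (h1 c t hc)
    intro y
    rw [← hev, h0, Polynomial.eval_zero]
  have h3 : ∀ y z : ℂ, ∑ i ∈ Finset.range N, ∑ k ∈ K,
      a i k * y ^ (w k + i) * (e * y + κ * z) ^ i = 0 := by
    intro y
    set Q : Polynomial ℂ := ∑ i ∈ Finset.range N, ∑ k ∈ K, Polynomial.C (a i k * y ^ (w k + i)) *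
      (Polynomial.C (e * y) + Polynomial.C κ * Polynomial.X) ^ i with hQ
    have hev : ∀ z, Q.eval z = ∑ i ∈ Finset.range N, ∑ k ∈ K,
        a i k * y ^ (w k + i) * (e * y + κ * z) ^ i := by
      intro z
      simp [hQ, Polynomial.eval_finsetSum]
    have h0 : Q = 0 := by
      refine Polynomial.eq_zero_of_infinite_isRoot Q ?_
      refine (Set.infinite_range_of_injective (f := fun t : ℕ => ((t + 1 : ℤ) : ℂ)) ?_).mono ?_
      · intro s t hst
        simpa using hst
      · rintro _ ⟨t, rfl⟩
        exact (hev _).trans (h2 (t + 1) (by omega) y)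
    intro z
    rw [← hev, h0, Polynomial.eval_zero]
  have h4 : ∀ i < N, ∀ y : ℂ, ∑ k ∈ K, a i k * y ^ (w k + i) = 0 := by
    intro i hi y
    set Q : Polynomial ℂ := ∑ i ∈ Finset.range N, Polynomial.C (∑ k ∈ K, a i k * y ^ (w k + i)) *
      Polynomial.X ^ i with hQ
    have h0 : Q = 0 := by
      refine Polynomial.funext fun x => ?_
      -- This choice of z makes e y + κ z equal to x.
      have := h3 y ((x - e * y) / κ)
      rw [mul_div_cancel₀ _ hκ, add_sub_cancel] at this
      simpa [hQ, Polynomial.eval_finsetSum, Finset.sum_mul] using this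
    have := congrArg (fun Q => Polynomial.coeff Q i) h0
    simp only [hQ, Polynomial.finsetSum_coeff, Polynomial.coeff_C_mul, Polynomial.coeff_X_pow,
      Polynomial.coeff_zero] at this
    simpa [hi] using this
  intro i hi k hk
  set Q : Polynomial ℂ := ∑ k ∈ K, Polynomial.C (a i k) * Polynomial.X ^ (w k + i) with hQ
  have h0 : Q = 0 := by
    refine Polynomial.funext fun x => ?_
    simpa [hQ, Polynomial.eval_finsetSum] using h4 i hi x
  have h5 := congrArg (fun Q => Polynomial.coeff Q (w k + i)) h0
  simp only [hQ, Polynomial.finsetSum_coeff, Polynomial.coeff_C_mul, Polynomial.coeff_X_pow,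
    Polynomial.coeff_zero] at h5
  rw [Finset.sum_eq_single_of_mem k hk] at h5
  · simpa using h5
  · intro l hl hlk
    have : w k + i ≠ w l + i := by
      have := hB k hk
      have := hB l hl
      simp only [hw]
      omega
    rw [if_neg this, mul_zero]

/-- An algebraic relation becomes an identity of functions on ℍ. Evaluating it at γτ for many γ,
with the coefficients split into pure weights, separates both the weights and the powers of 𝔾₂
because of the anomalous term in `E2_smul`. So every coefficient vanishes at every τ. -/
theorem transcendental_eisensteinG2 : Transcendental modularSubalgebra eisensteinG2 := by
  classical
  rw [transcendental_iff]
  intro p hp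
  choose F hF using fun i => exists_qExpansionRingHom_eq (p.coeff i).2
  set K : Finset ℤ := (Finset.range (p.natDegree + 1)).biUnion fun i => DFinsupp.support (F i)
    with hK
  have hval : HasValue (Polynomial.aeval eisensteinG2 p)
      (∑ i ∈ Finset.range (p.natDegree + 1),
        (∑ k ∈ K, ⇑(F i k)) * (fun τ => -1 / 24 * E2 τ) ^ i) := by
    rw [Polynomial.aeval_eq_sum_range]
    refine HasValue.sum fun i hi => ?_
    rw [Algebra.smul_def]
    refine HasValue.mul ?_ (hasValue_eisensteinG2.pow i)
    have h : algebraMap modularSubalgebra (PowerSeries ℂ) (p.coeff i) = (p.coeff i).1 := rfl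
    rw [h, ← hF i]
    refine hasValue_qExpansionRingHom _ _ fun k hk => ?_
    by_contra hne
    exact hk (Finset.mem_biUnion.2 ⟨i, hi, DFinsupp.mem_support_iff.2 hne⟩)
  rw [hp] at hval
  have hzero := hval.unique (by simpa using hasValue_C 0)
  have hF0 : ∀ τ : ℍ, ∀ i < p.natDegree + 1, ∀ k ∈ K, F i k τ = 0 := by
    intro τ
    refine coeff_eq_zero_of_forall_sum_eq_zero (e := -1 / 24 * E2 τ)
      (κ := Complex.I / (4 * Real.pi)) (τ := τ) ?_ ?_ ?_
    · simp [Real.pi_ne_zero]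
    · exact τ.im_pos.ne'
    · intro c t
      let γ : SL(2, ℤ) := ⟨!![1, t; c, 1 + c * t], by rw [Matrix.det_fin_two_of]; ring⟩
      have h := congrFun hzero (γ • τ)
      simp only [Finset.sum_apply, Pi.mul_apply, Pi.pow_apply, modularForm_smul, E2_smul] at h
      have h10 : γ 1 0 = c := rfl
      have h11 : γ 1 1 = 1 + c * t := rfl
      rw [h10, h11] at h
      push_cast at h
      rw [← h]
      refine Finset.sum_congr rfl fun i _ => ?_
      rw [Finset.sum_mul]
      refine Finset.sum_congr rfl fun k _ => ?_
      ring
  have hF1 : ∀ i, p.coeff i = 0 := by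
    intro i
    rcases lt_or_ge p.natDegree i with hi | hi
    · exact Polynomial.coeff_eq_zero_of_natDegree_lt hi
    have h0 : F i = 0 := by
      refine DFinsupp.ext fun k => ?_
      by_cases hk : k ∈ K
      · exact DFunLike.ext _ _ fun τ => hF0 τ i (by omega) k hk
      · by_contra hne
        exact hk (Finset.mem_biUnion.2
          ⟨i, Finset.mem_range.2 (by omega), DFinsupp.mem_support_iff.2 hne⟩)
    refine Subtype.ext ?_
    rw [← hF i, h0, map_zero]
    rfl
  exact Polynomial.ext hF1

/-! ### Quasimodular forms and the derivation -/

theorem modularSubalgebra_le : modularSubalgebra ≤ quasimodularForms := fun _ h =>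
  Algebra.subset_adjoin (Or.inl h)

/-- Polynomials in `𝔾₂` over the ring of modular forms. -/
def polynomialToQuasimodular : Polynomial modularSubalgebra →ₐ[ℚ] quasimodularForms :=
  AlgHom.codRestrict
    ((Polynomial.aeval (R := modularSubalgebra) eisensteinG2).restrictScalars ℚ)
    quasimodularForms fun p => by
      rw [AlgHom.restrictScalars_apply, Polynomial.aeval_eq_sum_range]
      refine Subalgebra.sum_mem _ fun i _ => ?_
      rw [Algebra.smul_def]
      exact mul_mem (modularSubalgebra_le (p.coeff i).2) (pow_mem quasiG2.2 i)

theorem polynomialToQuasimodular_bijective : Function.Bijective polynomialToQuasimodular := by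
  constructor
  · intro p r h
    refine transcendental_iff_injective.1 transcendental_eisensteinG2 ?_
    exact congrArg Subtype.val h
  · rintro ⟨x, hx⟩
    have h : quasimodularForms ≤ (quasimodularForms.val.comp polynomialToQuasimodular).range := by
      refine Algebra.adjoin_le ?_
      rintro y (hy | rfl)
      · exact ⟨Polynomial.C ⟨y, hy⟩, Polynomial.aeval_C _ _⟩
      · exact ⟨Polynomial.X, Polynomial.aeval_X _⟩
    obtain ⟨p, hp⟩ := h hx
    exact ⟨p, Subtype.ext hp⟩

/-- The ring of quasimodular forms is the ring of polynomials in `𝔾₂` over the ring of modular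
forms. -/
def quasimodularEquiv : Polynomial modularSubalgebra ≃ₐ[ℚ] quasimodularForms :=
  AlgEquiv.ofBijective polynomialToQuasimodular polynomialToQuasimodular_bijective

theorem quasimodularEquiv_C (x : modularSubalgebra) :
    quasimodularEquiv (Polynomial.C x) = ⟨x, modularSubalgebra_le x.2⟩ :=
  Subtype.ext (Polynomial.aeval_C _ _)

theorem quasimodularEquiv_X : quasimodularEquiv Polynomial.X = quasiG2 :=
  Subtype.ext (Polynomial.aeval_X _)

/-- The derivation `-1/2 d/d𝔾₂`. -/
def anomalyDerivation : Derivation ℚ quasimodularForms quasimodularForms :=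
  Derivation.mk' ((-1 / 2 : ℚ) • (quasimodularEquiv.toLinearMap ∘ₗ
    (Polynomial.derivative (R := modularSubalgebra)).restrictScalars ℚ ∘ₗ
      quasimodularEquiv.symm.toLinearMap)) fun a b => by
    simp only [LinearMap.smul_apply, LinearMap.comp_apply, AlgEquiv.toLinearMap_apply, map_mul,
      LinearMap.restrictScalars_apply, Polynomial.derivative_mul, map_add,
      AlgEquiv.apply_symm_apply, smul_eq_mul]
    rw [smul_add, mul_smul_comm, mul_smul_comm, add_comm]
    ring_nf

theorem anomalyDerivation_quasimodularEquiv (p : Polynomial modularSubalgebra) :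
    anomalyDerivation (quasimodularEquiv p) =
      (-1 / 2 : ℚ) • quasimodularEquiv (Polynomial.derivative p) := by
  simp [anomalyDerivation]

theorem isAnomalyDerivation_anomalyDerivation : IsAnomalyDerivation anomalyDerivation := by
  constructor
  · intro x hx
    have h : x = quasimodularEquiv (Polynomial.C ⟨x, hx⟩) := by rw [quasimodularEquiv_C]
    rw [h, anomalyDerivation_quasimodularEquiv]
    simp
  · rw [← quasimodularEquiv_X, anomalyDerivation_quasimodularEquiv, Polynomial.derivative_X,
      map_one, Algebra.algebraMap_eq_smul_one]

theorem IsAnomalyDerivation.eq_anomalyDerivation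
    {D : Derivation ℚ quasimodularForms quasimodularForms} (hD : IsAnomalyDerivation D) :
    D = anomalyDerivation := by
  ext1 x
  obtain ⟨p, rfl⟩ := quasimodularEquiv.surjective x
  have hA := isAnomalyDerivation_anomalyDerivation
  induction p using Polynomial.induction_on' with
  | add p q hp hq => rw [map_add, map_add, map_add, hp, hq]
  | monomial n a =>
    have h1 : D (quasimodularEquiv (Polynomial.C a)) =
        anomalyDerivation (quasimodularEquiv (Polynomial.C a)) := by
      rw [hD.1 _ (by rw [quasimodularEquiv_C]; exact a.2),
        hA.1 _ (by rw [quasimodularEquiv_C]; exact a.2)]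
    rw [← Polynomial.C_mul_X_pow_eq_monomial, map_mul, map_pow, quasimodularEquiv_X,
      Derivation.leibniz, Derivation.leibniz, Derivation.leibniz_pow, Derivation.leibniz_pow, h1,
      hD.2, hA.2]

/-- In characteristic zero a polynomial in 𝔾₂ with zero derivative is constant, that is, an element
of M. -/
theorem anomalyDerivation_eq_zero_iff (x : quasimodularForms) :
    anomalyDerivation x = 0 ↔ (x : PowerSeries ℂ) ∈ modularForms := by
  refine ⟨fun h => ?_, isAnomalyDerivation_anomalyDerivation.1 x⟩
  obtain ⟨p, rfl⟩ := quasimodularEquiv.surjective x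
  rw [anomalyDerivation_quasimodularEquiv, smul_eq_zero] at h
  have h1 : Polynomial.derivative p = 0 := by
    rcases h with h | h
    · norm_num at h
    · exact (map_eq_zero_iff _ quasimodularEquiv.injective).1 h
  have : IsAddTorsionFree modularSubalgebra := IsAddTorsionFree.of_module_rat _
  rw [Polynomial.eq_C_of_natDegree_eq_zero (Polynomial.derivative_eq_zero.1 h1),
    quasimodularEquiv_C]
  exact (p.coeff 0).2

/-! ### Eisenstein series -/

/-- The series `∑_{n ≥ 1} σ_r(n) qⁿ`. -/
def sigmaSeries (r : ℕ) : PowerSeries ℂ :=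
  PowerSeries.mk fun n => (ArithmeticFunction.sigma r n : ℂ)

theorem sigmaSeries_one : sigmaSeries 1 = eisensteinG2 + PowerSeries.C (1 / 24) := by
  ext n
  rw [map_add, PowerSeries.coeff_C, sigmaSeries, eisensteinG2, PowerSeries.coeff_mk,
    PowerSeries.coeff_mk]
  by_cases h : n = 0 <;> simp [h]
  norm_num

theorem C_ratCast_mem_modularForms (r : ℚ) : PowerSeries.C (r : ℂ) ∈ modularForms := by
  rw [← mul_one (PowerSeries.C _), ← rat_smul_eq_C_mul]
  exact Submodule.smul_mem _ _ one_mem_modularForms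

/-- The series is a rational multiple of E_{r+1} - 1. The constant may be subtracted because M
contains sums of mixed weights. -/
theorem sigmaSeries_mem_modularForms {r : ℕ} (hr : Odd r) (h1 : r ≠ 1) :
    sigmaSeries r ∈ modularForms := by
  have hk : 3 ≤ r + 1 := by obtain ⟨m, rfl⟩ := hr; omega
  have hk2 : Even (r + 1) := hr.add_one
  have hE : qExpansion 1 (E hk) ∈ modularForms := by
    refine qExpansion_mem_modularForms _ fun n => ?_
    rw [E_qExpansion_coeff hk hk2]
    refine ⟨if n = 0 then 1 else -(2 * (r + 1 : ℕ) / bernoulli (r + 1)) *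
      (ArithmeticFunction.sigma (r + 1 - 1) n), ?_⟩
    split_ifs <;> push_cast <;> rfl
  -- By Euler's formula a vanishing Bernoulli number would give a zero of ζ at an even integer
  -- greater than 1.
  have hb : bernoulli (r + 1) ≠ 0 := by
    intro h0
    obtain ⟨m, hm⟩ := hk2.two_dvd
    have hz := riemannZeta_two_mul_nat (k := m) (by omega)
    rw [← hm, h0] at hz
    refine riemannZeta_ne_zero_of_one_lt_re (s := 2 * m) ?_ (by simpa using hz)
    have : 2 ≤ m := by omega
    have : (2 : ℝ) ≤ m := by exact_mod_cast this
    simp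
    linarith
  set β : ℚ := -(2 * (r + 1 : ℕ) / bernoulli (r + 1)) with hβ
  have hβ0 : β ≠ 0 := by
    rw [hβ]
    have : ((r + 1 : ℕ) : ℚ) ≠ 0 := by exact_mod_cast r.succ_ne_zero
    simp only [neg_ne_zero]
    positivity
  have h : sigmaSeries r = PowerSeries.C ((β⁻¹ : ℚ) : ℂ) *
      (qExpansion 1 (E hk) + PowerSeries.C ((-1 : ℚ) : ℂ)) := by
    ext n
    rw [PowerSeries.coeff_C_mul, map_add, E_qExpansion_coeff hk hk2, PowerSeries.coeff_C,
      sigmaSeries, PowerSeries.coeff_mk]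
    by_cases hn : n = 0
    · simp [hn]
    · have hβ0' : (β : ℂ) ≠ 0 := by exact_mod_cast hβ0
      have hβ2 : (β : ℂ) = -(2 * (r + 1 : ℕ) / bernoulli (r + 1)) := by rw [hβ]; push_cast; rfl
      simp only [hn, if_false, add_zero, Nat.add_sub_cancel]
      rw [← hβ2]
      push_cast
      field_simp
  rw [h]
  exact mul_mem_modularForms (C_ratCast_mem_modularForms _)
    (add_mem hE (C_ratCast_mem_modularForms _))

end ModularForms

/-! ### Truncation of the symbol of a differential polynomial -/

/-- The sum `v_j = ∑ (i k)^j ω_k`, taken over `|k| ≤ N`. -/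
def truncV (N : ℕ) (j : ℕ) : MvPolynomial ℤ ℂ :=
  ∑ k ∈ Finset.Icc (-N : ℤ) N, MvPolynomial.C ((Complex.I * (k : ℂ)) ^ j) * MvPolynomial.X k

/-- The momentum `∑ k m_k` of the monomial `∏ ω_k ^ m_k`. -/
abbrev momentum : (ℤ →₀ ℕ) →+ ℤ := Finsupp.weight (fun k : ℤ => k)

theorem coeff_truncV_single (N j : ℕ) {k : ℤ} (hk : k ∈ Finset.Icc (-N : ℤ) N) :
    MvPolynomial.coeff (Finsupp.single k 1) (truncV N j) = (Complex.I * (k : ℂ)) ^ j := by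
  classical
  rw [truncV, MvPolynomial.coeff_sum, Finset.sum_eq_single_of_mem k hk]
  · rw [MvPolynomial.coeff_C_mul, MvPolynomial.coeff_X, if_pos rfl, mul_one]
  · intro l _ hl
    rw [MvPolynomial.coeff_C_mul, MvPolynomial.coeff_X,
      if_neg fun h => hl (Finsupp.single_left_injective one_ne_zero h), mul_zero]

theorem coeff_truncV_of_ne (N j : ℕ) {m : ℤ →₀ ℕ} (hm : ∀ k, m ≠ Finsupp.single k 1) :
    MvPolynomial.coeff m (truncV N j) = 0 := by
  classical
  rw [truncV, MvPolynomial.coeff_sum]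
  refine Finset.sum_eq_zero fun k _ => ?_
  rw [MvPolynomial.coeff_C_mul, MvPolynomial.coeff_X, if_neg (hm k).symm, mul_zero]

theorem coeff_fourierV (N j : ℕ) {m : ℤ →₀ ℕ} (hm : m.support ⊆ Finset.Icc (-N : ℤ) N) :
    MvPowerSeries.coeff m (fourierV j) =
      MvPolynomial.coeff m (truncV N j) • LaurentPolynomial.T (momentum m) := by
  classical
  change fourierV j m = _
  by_cases h : ∃ k, m = Finsupp.single k 1
  · obtain ⟨k, rfl⟩ := h
    rw [coeff_truncV_single N j (hm (by simp))]
    simp [fourierV, Finsupp.weight_single]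
  · push Not at h
    rw [coeff_truncV_of_ne N j h]
    simp [fourierV, h]

/-- Each ω_k comes with e^{ikx}, so a monomial comes with e^{ix} to the power of its momentum. The
mean over a period therefore selects momentum zero. -/
theorem coeff_aeval_fourierV (N : ℕ) (g : MvPolynomial ℕ ℚ) :
    ∀ m : ℤ →₀ ℕ, m.support ⊆ Finset.Icc (-N : ℤ) N →
      MvPowerSeries.coeff m (MvPolynomial.aeval fourierV g) =
        MvPolynomial.coeff m (MvPolynomial.aeval (truncV N) g) •
          LaurentPolynomial.T (momentum m) := by
  classical
  induction g using MvPolynomial.induction_on with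
  | C a =>
    intro m _
    rw [MvPolynomial.aeval_C, MvPolynomial.aeval_C, MvPowerSeries.algebraMap_apply,
      MvPowerSeries.coeff_C, IsScalarTower.algebraMap_apply ℚ ℂ (LaurentPolynomial ℂ),
      IsScalarTower.algebraMap_apply ℚ ℂ (MvPolynomial ℤ ℂ), MvPolynomial.algebraMap_eq,
      MvPolynomial.coeff_C, Algebra.algebraMap_eq_smul_one]
    by_cases hm : m = 0
    · simp [hm]
    · simp [hm, Ne.symm hm]
  | add p q hp hq =>
    intro m hm
    rw [map_add, map_add, map_add, hp m hm, hq m hm, MvPolynomial.coeff_add, add_smul]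
  | mul_X p j h =>
    intro m hm
    rw [map_mul (MvPolynomial.aeval fourierV), map_mul (MvPolynomial.aeval (truncV N)),
      MvPolynomial.aeval_X, MvPolynomial.aeval_X, MvPowerSeries.coeff_mul,
      MvPolynomial.coeff_mul, Finset.sum_smul]
    refine Finset.sum_congr rfl fun x hx => ?_
    have hx' := Finset.HasAntidiagonal.mem_antidiagonal.1 hx
    have h1 : x.1.support ⊆ m.support := Finsupp.support_mono (by rw [← hx']; exact le_self_add)
    have h2 : x.2.support ⊆ m.support := Finsupp.support_mono (by rw [← hx']; exact le_add_self)
    rw [h _ (h1.trans hm), coeff_fourierV N j (h2.trans hm), ← hx', map_add,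
      LaurentPolynomial.T_add, smul_mul_smul_comm]

theorem meanCoeff_eq (N : ℕ) (g : MvPolynomial ℕ ℚ) (m : ℤ →₀ ℕ)
    (hm : m.support ⊆ Finset.Icc (-N : ℤ) N) :
    meanCoeff g m = if momentum m = 0 then
      MvPolynomial.coeff m (MvPolynomial.aeval (truncV N) g) else 0 := by
  rw [meanCoeff, coeff_aeval_fourierV N g m hm]
  rw [LaurentPolynomial.T, AddMonoidAlgebra.coeff_smul, Finsupp.smul_apply,
    AddMonoidAlgebra.coeff_single, Finsupp.single_apply]
  split_ifs <;> simp

theorem exists_support_subset_Icc (m : ℤ →₀ ℕ) :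
    ∃ N : ℕ, m.support ⊆ Finset.Icc (-N : ℤ) N := by
  refine ⟨∑ k ∈ m.support, k.natAbs, fun k hk => ?_⟩
  have := Finset.single_le_sum (f := Int.natAbs) (fun _ _ => Nat.zero_le _) hk
  rw [Finset.mem_Icc]
  omega

theorem meanCoeff_eq_zero_of_momentum_ne_zero (g : MvPolynomial ℕ ℚ) {m : ℤ →₀ ℕ}
    (hm : momentum m ≠ 0) : meanCoeff g m = 0 := by
  obtain ⟨N, hN⟩ := exists_support_subset_Icc m
  rw [meanCoeff_eq N g m hN, if_neg hm]

/-! ### Normally ordered monomials shift the weight by the momentum -/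

/-- The integral version of the grading on the Fock space. -/
abbrev HasWeight (f : Fock) (d : ℤ) : Prop :=
  MvPolynomial.IsWeightedHomogeneous (fun k : ℕ+ => ((k : ℕ) : ℤ)) f d

theorem weight_int_eq (s : ℕ+ →₀ ℕ) :
    Finsupp.weight (fun k : ℕ+ => ((k : ℕ) : ℤ)) s = fockWeight s := by
  simp [Finsupp.weight_apply, Finsupp.sum]

theorem HasWeight.eq_zero_of_neg {f : Fock} {d : ℤ} (h : HasWeight f d) (hd : d < 0) : f = 0 := by
  ext s
  rw [MvPolynomial.coeff_zero]
  refine h.coeff_eq_zero s ?_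
  rw [weight_int_eq]
  omega

theorem HasWeight.opP (c : ℂ) (k : ℤ) {f : Fock} {d : ℤ} (h : HasWeight f d) :
    HasWeight (opP c k f) (d + k) := by
  rcases lt_trichotomy k 0 with hk | rfl | hk
  · obtain ⟨n, rfl⟩ := exists_pnat_of_neg hk
    rw [opP_neg_natCast_pos]
    exact (MvPolynomial.weightedHomogeneousSubmodule ℂ _ _).smul_mem _
      (MvPolynomial.IsWeightedHomogeneous.pderiv h (by simp))
  · rw [opP_zero, add_zero]
    exact (MvPolynomial.weightedHomogeneousSubmodule ℂ _ _).smul_mem c h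
  · obtain ⟨n, rfl⟩ := exists_pnat_of_pos hk
    rw [opP_natCast_pos, add_comm]
    exact (MvPolynomial.isWeightedHomogeneous_X ℂ _ n).mul h

theorem finsupp_nat_induction {σ : Type*} {P : (σ →₀ ℕ) → Prop} (zero : P 0)
    (step : ∀ m k, P m → P (m + Finsupp.single k 1)) (m : σ →₀ ℕ) : P m := by
  induction m using Finsupp.induction with
  | zero => exact zero
  | single_add a b f _ _ ih =>
    clear * - ih step
    induction b with
    | zero => simpa using ih
    | succ b hb =>
      rw [Finsupp.single_add, add_right_comm]
      exact step _ _ hb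

theorem HasWeight.normalOrdered (c : ℂ) (m : ℤ →₀ ℕ) :
    ∀ {f : Fock} {d : ℤ}, HasWeight f d → HasWeight (normalOrdered c m f) (d + momentum m) := by
  induction m using finsupp_nat_induction with
  | zero =>
    intro f d h
    simpa [QuantumKdV.normalOrdered] using h
  | step m k ih =>
    intro f d h
    rw [map_add, Finsupp.weight_single, one_smul]
    rcases le_or_gt 0 k with hk | hk
    · rw [normalOrdered_add_single_of_nonneg c m hk, ← add_assoc]
      exact (ih h).opP c k
    · rw [normalOrdered_add_single_of_neg c m hk, add_comm (momentum m), ← add_assoc]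
      exact ih (h.opP c k)

/-- If k > n occurs, the other factors have total momentum at most -k and push the weight below
zero; if k < -n occurs, one factor P_k can be made to act first and already does so. -/
theorem support_subset_of_normalOrdered_ne_zero {c : ℂ} {m : ℤ →₀ ℕ} (hm : momentum m = 0)
    {f : Fock} {n : ℕ} (hf : HasWeight f n) (h : normalOrdered c m f ≠ 0) :
    m.support ⊆ Finset.Icc (-n : ℤ) n := by
  intro k hk
  by_contra hn
  refine h ?_
  have h1 : m - Finsupp.single k 1 + Finsupp.single k 1 = m := by
    refine tsub_add_cancel_of_le ?_
    have := Finsupp.mem_support_iff.1 hk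
    simp; omega
  have h2 := congrArg momentum h1
  rw [map_add, Finsupp.weight_single, one_smul, hm] at h2
  rw [← h1]
  rw [Finset.mem_Icc, not_and_or] at hn
  rcases le_or_gt 0 k with hk | hk
  · rw [normalOrdered_add_single_of_nonneg c _ hk, Module.End.mul_apply,
      (hf.normalOrdered c (m - Finsupp.single k 1)).eq_zero_of_neg (by omega), map_zero]
  · rw [normalOrdered_add_single_of_neg c _ hk, Module.End.mul_apply,
      (hf.opP c k).eq_zero_of_neg (by omega), map_zero]

theorem hasWeight_monomial (s : ℕ+ →₀ ℕ) (a : ℂ) :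
    HasWeight (MvPolynomial.monomial s a) (fockWeight s) :=
  MvPolynomial.isWeightedHomogeneous_monomial _ _ _ (weight_int_eq s)

theorem normalOrder_eq_sum (c : ℂ) (f : MvPolynomial ℤ ℂ) :
    normalOrder c f = ∑ m ∈ f.support, MvPolynomial.coeff m f • normalOrdered c m := by
  conv_lhs => rw [f.as_sum]
  rw [map_sum]
  exact Finset.sum_congr rfl fun m _ => normalOrder_monomial c m _

theorem quantize_monomial (c : ℂ) (g : MvPolynomial ℕ ℚ) (s : ℕ+ →₀ ℕ) {N : ℕ}
    (hN : fockWeight s ≤ N) :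
    quantize c g (MvPolynomial.monomial s 1) =
      ∑ m ∈ (MvPolynomial.aeval (truncV N) g).support,
        meanCoeff g m • normalOrdered c m (MvPolynomial.monomial s 1) := by
  have h : MvPolynomial.monomial s (1 : ℂ) = MvPolynomial.basisMonomials ℕ+ ℂ s := by simp
  conv_lhs => rw [h, quantize, Module.Basis.constr_basis]
  refine finsum_eq_sum_of_support_subset _ fun m hm => ?_
  rw [Function.mem_support] at hm
  have h1 : momentum m = 0 := by
    by_contra h1
    exact hm (by rw [meanCoeff_eq_zero_of_momentum_ne_zero g h1, zero_smul])
  have h2 := support_subset_of_normalOrdered_ne_zero h1 (hasWeight_monomial s 1)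
    (right_ne_zero_of_smul hm)
  have h3 : m.support ⊆ Finset.Icc (-N : ℤ) N :=
    h2.trans (Finset.Icc_subset_Icc (by omega) (by omega))
  have h4 := left_ne_zero_of_smul hm
  rw [meanCoeff_eq N g m h3, if_pos h1] at h4
  simpa using h4

/-- The restriction to momentum zero disappears on the right: terms of nonzero momentum change the
weight and have no diagonal coefficients. Traces can thus be computed from the plain polynomial in
the truncated fields. -/
theorem coeff_quantize_monomial (c : ℂ) (g : MvPolynomial ℕ ℚ) (s : ℕ+ →₀ ℕ) {N : ℕ}
    (hN : fockWeight s ≤ N) :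
    MvPolynomial.coeff s (quantize c g (MvPolynomial.monomial s 1)) =
      MvPolynomial.coeff s (normalOrder c (MvPolynomial.aeval (truncV N) g)
        (MvPolynomial.monomial s 1)) := by
  rw [quantize_monomial c g s hN, normalOrder_eq_sum, LinearMap.sum_apply, MvPolynomial.coeff_sum,
    MvPolynomial.coeff_sum]
  refine Finset.sum_congr rfl fun m hm => ?_
  rw [LinearMap.smul_apply, MvPolynomial.coeff_smul, MvPolynomial.coeff_smul]
  have h := (hasWeight_monomial s 1).normalOrdered c m
  by_cases h1 : momentum m = 0
  · by_cases h2 : normalOrdered c m (MvPolynomial.monomial s 1) = 0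
    · rw [h2, MvPolynomial.coeff_zero, smul_zero, smul_zero]
    · have h3 := support_subset_of_normalOrdered_ne_zero h1 (hasWeight_monomial s 1) h2
      rw [meanCoeff_eq N g m (h3.trans (Finset.Icc_subset_Icc (by omega) (by omega))), if_pos h1]
  · rw [h.coeff_eq_zero s (by rw [weight_int_eq]; omega), smul_zero, smul_zero]

theorem coeff_traceSeries_quantize (c : ℂ) (g : MvPolynomial ℕ ℚ) {n N : ℕ} (hn : n ≤ N) :
    PowerSeries.coeff n (traceSeries (quantize c g)) =
      PowerSeries.coeff n (traceSeries (normalOrder c (MvPolynomial.aeval (truncV N) g))) := by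
  rw [coeff_traceSeries, coeff_traceSeries]
  refine Finset.sum_congr rfl fun s hs => coeff_quantize_monomial c g s ?_
  rw [mem_partitionsOf.1 hs]
  exact hn

/-! ### The Wick recursion -/

theorem pderiv_truncV (N j : ℕ) {k : ℤ} (hk : k ∈ Finset.Icc (-N : ℤ) N) :
    MvPolynomial.pderiv k (truncV N j) = MvPolynomial.C ((Complex.I * (k : ℂ)) ^ j) := by
  classical
  rw [truncV, map_sum, Finset.sum_eq_single_of_mem k hk]
  · simp
  · intro l _ hl
    simp [MvPolynomial.pderiv_X_of_ne hl]

/-- The chain rule. Only finitely many terms are nonzero, and summing over any sufficiently large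
finite set lets instances for several k and several polynomials share one index set. -/
theorem eventually_pderiv_aeval {σ τ : Type*} (v : σ → MvPolynomial τ ℂ) (k : τ)
    (g : MvPolynomial σ ℚ) : ∀ᶠ s : Finset σ in Filter.atTop,
      MvPolynomial.pderiv k (MvPolynomial.aeval v g) = ∑ l ∈ s,
        MvPolynomial.aeval v (MvPolynomial.pderiv l g) * MvPolynomial.pderiv k (v l) := by
  classical
  induction g using MvPolynomial.induction_on with
  | C a =>
    refine Filter.Eventually.of_forall fun s => ?_
    rw [MvPolynomial.aeval_C, IsScalarTower.algebraMap_apply ℚ ℂ (MvPolynomial τ ℂ),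
      MvPolynomial.algebraMap_eq, MvPolynomial.pderiv_C]
    simp
  | add p q hp hq =>
    filter_upwards [hp, hq] with s hp hq
    simp only [map_add, hp, hq, add_mul, Finset.sum_add_distrib]
  | mul_X p j h =>
    filter_upwards [h, Filter.eventually_ge_atTop {j}] with s h hj
    have hj : j ∈ s := by simpa using hj
    have h1 : ∀ l ∈ s, MvPolynomial.aeval v (MvPolynomial.pderiv l (p * MvPolynomial.X j)) *
        MvPolynomial.pderiv k (v l) = MvPolynomial.aeval v (MvPolynomial.pderiv l p) *
          MvPolynomial.pderiv k (v l) * v j + if l = j then MvPolynomial.aeval v p *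
            MvPolynomial.pderiv k (v j) else 0 := by
      intro l _
      rw [MvPolynomial.pderiv_mul, map_add, map_mul, map_mul, MvPolynomial.aeval_X]
      split_ifs with hl
      · subst hl
        rw [MvPolynomial.pderiv_X_self, map_one]
        ring
      · rw [MvPolynomial.pderiv_X_of_ne (Ne.symm hl), map_zero]
        ring
    rw [Finset.sum_congr rfl h1, Finset.sum_add_distrib, ← Finset.sum_mul, ← h,
      Finset.sum_ite_eq' s j, if_pos hj, map_mul, MvPolynomial.pderiv_mul, MvPolynomial.aeval_X]

/-- The series `k q^k / (1 - q^k)`. -/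
def lambertTerm (k : ℕ) : PowerSeries ℂ :=
  PowerSeries.mk fun n => if n ≠ 0 ∧ k ∣ n then (k : ℂ) else 0

theorem one_sub_X_pow_mul_lambertTerm {k : ℕ} (hk : k ≠ 0) :
    (1 - PowerSeries.X ^ k) * lambertTerm k = (k : PowerSeries ℂ) * PowerSeries.X ^ k := by
  ext n
  rw [sub_mul, one_mul, map_sub, PowerSeries.coeff_X_pow_mul', lambertTerm, PowerSeries.coeff_mk,
    PowerSeries.coeff_mk, ← map_natCast PowerSeries.C, PowerSeries.coeff_C_mul,
    PowerSeries.coeff_X_pow]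
  rcases lt_trichotomy n k with h | rfl | h
  · have : ¬ (n ≠ 0 ∧ k ∣ n) := fun h1 => absurd (Nat.le_of_dvd (by omega) h1.2) (by omega)
    simp [this, h.ne, h]
  · simp [hk]
  · have h1 : k ∣ n - k ↔ k ∣ n := by
      rw [Nat.dvd_sub_iff_left h.le dvd_rfl]
    have h2 : n - k ≠ 0 := by omega
    have h3 : n ≠ 0 := by omega
    simp [h1, h2, h3, h.le, h.ne']

theorem traceSeries_normalOrder_mul_X_eq (c : ℂ) (f : MvPolynomial ℤ ℂ) {k : ℤ} (hk : k ≠ 0) :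
    traceSeries (normalOrder c (f * MvPolynomial.X k)) =
      lambertTerm k.natAbs * traceSeries (normalOrder c (MvPolynomial.pderiv (-k) f)) := by
  have hk' : k.natAbs ≠ 0 := by omega
  have h := traceSeries_normalOrder_mul_X c f hk
  rw [← one_sub_X_pow_mul_lambertTerm hk', mul_assoc] at h
  refine mul_left_cancel₀ (fun h0 => ?_) h
  have := congrArg PowerSeries.constantCoeff h0
  simp [hk'] at this

/-- The truncated propagator. -/
def truncPropagator (N j l : ℕ) : PowerSeries ℂ :=
  ∑ k ∈ (Finset.Icc (-N : ℤ) N).erase 0,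
    PowerSeries.C ((Complex.I * (k : ℂ)) ^ j * (Complex.I * ((-k : ℤ) : ℂ)) ^ l) *
      lambertTerm k.natAbs

/-- The mode k = 0 of the new factor gives c, and only for j = 0, as 0 ^ j expresses; each mode k ≠
0 is contracted with ω_{-k} by the chain rule. -/
theorem eventually_traceSeries_truncV_mul (c : ℂ) (N j : ℕ) (g : MvPolynomial ℕ ℚ) :
    ∀ᶠ s : Finset ℕ in Filter.atTop,
      traceSeries (normalOrder c (MvPolynomial.aeval (truncV N) (g * MvPolynomial.X j))) =
        PowerSeries.C (0 ^ j * c) *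
          traceSeries (normalOrder c (MvPolynomial.aeval (truncV N) g)) +
        ∑ l ∈ s, truncPropagator N j l *
          traceSeries (normalOrder c (MvPolynomial.aeval (truncV N) (MvPolynomial.pderiv l g))) := by
  have h : ∀ᶠ s : Finset ℕ in Filter.atTop, ∀ k ∈ Finset.Icc (-N : ℤ) N,
      MvPolynomial.pderiv k (MvPolynomial.aeval (truncV N) g) = ∑ l ∈ s,
        MvPolynomial.aeval (truncV N) (MvPolynomial.pderiv l g) *
          MvPolynomial.pderiv k (truncV N l) :=
    (Filter.eventually_all_finset _).2 fun k _ => eventually_pderiv_aeval _ k g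
  filter_upwards [h] with s hs
  set Φ := MvPolynomial.aeval (truncV N) g with hΦ
  have hC : ∀ (a : ℂ) (f : MvPolynomial ℤ ℂ), traceSeries (normalOrder c (MvPolynomial.C a * f)) =
      PowerSeries.C a * traceSeries (normalOrder c f) := by
    intro a f
    rw [← MvPolynomial.smul_eq_C_mul, map_smul, map_smul, PowerSeries.smul_eq_C_mul]
  rw [map_mul, MvPolynomial.aeval_X, truncV, Finset.mul_sum, map_sum, map_sum,
    ← Finset.add_sum_erase _ _ (show (0 : ℤ) ∈ Finset.Icc (-N : ℤ) N by simp)]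
  congr 1
  · rw [mul_left_comm, hC, traceSeries_normalOrder_mul_X_zero, ← mul_assoc, ← map_mul,
      Int.cast_zero, mul_zero]
  · simp only [truncPropagator, Finset.sum_mul]
    rw [Finset.sum_comm]
    refine Finset.sum_congr rfl fun k hk => ?_
    obtain ⟨hk0, hk⟩ := Finset.mem_erase.1 hk
    have hk' : -k ∈ Finset.Icc (-N : ℤ) N := by
      rw [Finset.mem_Icc] at hk ⊢
      omega
    rw [mul_left_comm, hC, traceSeries_normalOrder_mul_X_eq c _ hk0, hs _ hk', map_sum, map_sum,
      Finset.mul_sum, Finset.mul_sum]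
    refine Finset.sum_congr rfl fun l _ => ?_
    rw [pderiv_truncV N l hk', mul_comm _ (MvPolynomial.C _), hC, map_mul]
    ring

/-- The propagator `∑_{k ≠ 0} (i k)^j (-i k)^l |k| q^|k| / (1 - q^|k|)`. -/
def propagator (j l : ℕ) : PowerSeries ℂ :=
  PowerSeries.C ((-1) ^ l * Complex.I ^ (j + l) * (1 + (-1) ^ (j + l))) * sigmaSeries (j + l + 1)

/-- Pairing k with -k produces the factor 1 + (-1)^(j+l). Only divisors of n contribute to the
coefficient of qⁿ, and for n > 0 these are at most N; for n = 0 both sides vanish. -/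
theorem coeff_truncPropagator {n N : ℕ} (hn : n ≤ N) (j l : ℕ) :
    PowerSeries.coeff n (truncPropagator N j l) = PowerSeries.coeff n (propagator j l) := by
  have h1 : truncPropagator N j l = ∑ k ∈ Finset.Icc 1 N,
      PowerSeries.C ((-1) ^ l * Complex.I ^ (j + l) * (1 + (-1) ^ (j + l)) * (k : ℂ) ^ (j + l)) *
        lambertTerm k := by
    rw [truncPropagator, ← Finset.sum_filter_add_sum_filter_not _ (fun k : ℤ => 0 < k)]
    have h2 : ∑ k ∈ ((Finset.Icc (-N : ℤ) N).erase 0).filter (fun k : ℤ => 0 < k),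
        PowerSeries.C ((Complex.I * (k : ℂ)) ^ j * (Complex.I * ((-k : ℤ) : ℂ)) ^ l) *
          lambertTerm k.natAbs = ∑ k ∈ Finset.Icc 1 N,
        PowerSeries.C ((Complex.I * (k : ℂ)) ^ j * (Complex.I * (-(k : ℂ))) ^ l) *
          lambertTerm k := by
      refine Finset.sum_nbij' Int.natAbs (fun k => (k : ℤ)) ?_ ?_ ?_ ?_ ?_ <;>
        simp only [Finset.mem_filter, Finset.mem_erase, Finset.mem_Icc]
      · intro k hk; omega
      · intro k hk; omega
      · intro k hk; omega
      · intro k hk; omega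
      · intro k hk
        obtain ⟨n, rfl⟩ := exists_pnat_of_pos hk.2
        simp
    have h3 : ∑ k ∈ ((Finset.Icc (-N : ℤ) N).erase 0).filter (fun k : ℤ => ¬ 0 < k),
        PowerSeries.C ((Complex.I * (k : ℂ)) ^ j * (Complex.I * ((-k : ℤ) : ℂ)) ^ l) *
          lambertTerm k.natAbs = ∑ k ∈ Finset.Icc 1 N,
        PowerSeries.C ((Complex.I * (-(k : ℂ))) ^ j * (Complex.I * (k : ℂ)) ^ l) *
          lambertTerm k := by
      refine Finset.sum_nbij' Int.natAbs (fun k => -(k : ℤ)) ?_ ?_ ?_ ?_ ?_ <;>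
        simp only [Finset.mem_filter, Finset.mem_erase, Finset.mem_Icc]
      · intro k hk; omega
      · intro k hk; omega
      · intro k hk; omega
      · intro k hk; omega
      · intro k hk
        obtain ⟨n, rfl⟩ := exists_pnat_of_neg (show k < 0 by omega)
        simp
    rw [h2, h3, ← Finset.sum_add_distrib]
    refine Finset.sum_congr rfl fun k _ => ?_
    rw [← add_mul, ← map_add]
    congr 2
    have h4 : (Complex.I * -(k : ℂ)) = -1 * (Complex.I * k) := by ring
    have h5 : ((-1 : ℂ) ^ l) * (-1) ^ l = 1 := by rw [← mul_pow]; simp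
    rw [h4, mul_pow (-1), mul_pow (-1), mul_pow Complex.I, mul_pow Complex.I, pow_add, pow_add,
      pow_add]
    linear_combination (-(Complex.I ^ j * Complex.I ^ l * k ^ j * k ^ l * (-1) ^ j)) * h5
  rw [h1, map_sum, propagator, PowerSeries.coeff_C_mul, sigmaSeries, PowerSeries.coeff_mk,
    ArithmeticFunction.sigma_apply]
  push_cast
  rw [Finset.mul_sum]
  simp only [PowerSeries.coeff_C_mul, lambertTerm, PowerSeries.coeff_mk, mul_ite, mul_zero]
  rw [← Finset.sum_filter]
  refine Finset.sum_congr ?_ fun k _ => by ring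
  ext k
  simp only [Finset.mem_filter, Finset.mem_Icc, Nat.mem_divisors]
  refine ⟨fun h => ⟨h.2.2, h.2.1⟩, fun h => ⟨⟨Nat.pos_of_dvd_of_pos h.1 (by omega),
    (Nat.le_of_dvd (by omega) h.1).trans hn⟩, h.2, h.1⟩⟩

theorem coeff_mul_congr {R : Type*} [CommRing R] {a a' b b' : PowerSeries R} {n : ℕ}
    (ha : ∀ i ≤ n, PowerSeries.coeff i a = PowerSeries.coeff i a')
    (hb : ∀ i ≤ n, PowerSeries.coeff i b = PowerSeries.coeff i b') :
    PowerSeries.coeff n (a * b) = PowerSeries.coeff n (a' * b') := by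
  rw [PowerSeries.coeff_mul, PowerSeries.coeff_mul]
  refine Finset.sum_congr rfl fun x hx => ?_
  have := Finset.HasAntidiagonal.mem_antidiagonal.1 hx
  rw [ha _ (by omega), hb _ (by omega)]

theorem traceSeries_quantize_add (c : ℂ) (g h : MvPolynomial ℕ ℚ) :
    traceSeries (quantize c (g + h)) = traceSeries (quantize c g) + traceSeries (quantize c h) := by
  ext n
  rw [map_add, coeff_traceSeries_quantize c _ le_rfl, coeff_traceSeries_quantize c _ le_rfl,
    coeff_traceSeries_quantize c _ le_rfl, map_add, map_add, map_add, map_add]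

theorem traceSeries_quantize_C (c : ℂ) (a : ℚ) :
    traceSeries (quantize c (MvPolynomial.C a)) = PowerSeries.C (a : ℂ) * traceSeries 1 := by
  ext n
  rw [coeff_traceSeries_quantize c _ le_rfl, MvPolynomial.aeval_C,
    IsScalarTower.algebraMap_apply ℚ ℂ (MvPolynomial ℤ ℂ), Algebra.algebraMap_eq_smul_one,
    map_smul, normalOrder_one, map_smul, PowerSeries.smul_eq_C_mul]
  simp

/-- The Wick recursion, with the sum over a large enough finite set of variables. -/
theorem eventually_coeff_traceSeries_quantize_mul_X (c : ℂ) (j : ℕ) (g : MvPolynomial ℕ ℚ) (n : ℕ) :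
    ∀ᶠ s : Finset ℕ in Filter.atTop,
      PowerSeries.coeff n (traceSeries (quantize c (g * MvPolynomial.X j))) =
        PowerSeries.coeff n (PowerSeries.C (0 ^ j * c) * traceSeries (quantize c g) +
          ∑ l ∈ s, propagator j l * traceSeries (quantize c (MvPolynomial.pderiv l g))) := by
  filter_upwards [eventually_traceSeries_truncV_mul c n j g] with s hs
  rw [coeff_traceSeries_quantize c _ le_rfl, hs, map_add, map_add, map_sum, map_sum]
  congr 1
  · exact coeff_mul_congr (fun _ _ => rfl) fun i hi => (coeff_traceSeries_quantize c g hi).symm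
  · exact Finset.sum_congr rfl fun l _ => coeff_mul_congr
      (fun i hi => coeff_truncPropagator hi j l)
      fun i hi => (coeff_traceSeries_quantize c _ hi).symm

/-! ### The `q`-bracket of a quantized differential polynomial -/

/-- The series `{ḡ(c)}_q`. -/
abbrev quantizeBracket (c : ℂ) (g : MvPolynomial ℕ ℚ) : PowerSeries ℂ := qBracket (quantize c g)

theorem quantizeBracket_add (c : ℂ) (g h : MvPolynomial ℕ ℚ) :
    quantizeBracket c (g + h) = quantizeBracket c g + quantizeBracket c h := by
  rw [quantizeBracket, qBracket_eq, traceSeries_quantize_add, add_mul, ← qBracket_eq,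
    ← qBracket_eq]

theorem quantizeBracket_C (c : ℂ) (a : ℚ) :
    quantizeBracket c (MvPolynomial.C a) = PowerSeries.C (a : ℂ) := by
  rw [quantizeBracket, qBracket_eq, traceSeries_quantize_C, mul_assoc, ← qBracket_eq,
    qBracket_one, mul_one]

theorem quantizeBracket_zero (c : ℂ) : quantizeBracket c 0 = 0 := by
  rw [← MvPolynomial.C_0, quantizeBracket_C, Rat.cast_zero, map_zero]

theorem traceSeries_quantize_zero (c : ℂ) : traceSeries (quantize c 0) = 0 := by
  rw [← MvPolynomial.C_0, traceSeries_quantize_C, Rat.cast_zero, map_zero, zero_mul]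

theorem quantizeBracket_mul_X (c : ℂ) (j : ℕ) (g : MvPolynomial ℕ ℚ) {s : Finset ℕ}
    (hs : g.vars ⊆ s) :
    quantizeBracket c (g * MvPolynomial.X j) = PowerSeries.C (0 ^ j * c) * quantizeBracket c g +
      ∑ l ∈ s, propagator j l * quantizeBracket c (MvPolynomial.pderiv l g) := by
  have h : traceSeries (quantize c (g * MvPolynomial.X j)) =
      PowerSeries.C (0 ^ j * c) * traceSeries (quantize c g) +
        ∑ l ∈ s, propagator j l * traceSeries (quantize c (MvPolynomial.pderiv l g)) := by
    ext n
    -- The index set from the truncated recursion depends on n; it can be cut down to the fixed `s`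
    -- because derivatives in variables absent from g vanish.
    obtain ⟨t, ht, hst⟩ := ((eventually_coeff_traceSeries_quantize_mul_X c j g n).and
      (Filter.eventually_ge_atTop s)).exists
    rw [ht]
    congr 2
    symm
    refine Finset.sum_subset hst fun l _ hl => ?_
    rw [MvPolynomial.pderiv_eq_zero_of_notMem_vars fun h => hl (hs h), traceSeries_quantize_zero,
      mul_zero]
  simp only [quantizeBracket, qBracket_eq, h, add_mul, Finset.sum_mul, mul_assoc]

theorem quantizeBracket_pderiv_mul_X (c : ℂ) (j : ℕ) (g : MvPolynomial ℕ ℚ) :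
    quantizeBracket c (MvPolynomial.pderiv 0 (g * MvPolynomial.X j)) =
      quantizeBracket c (MvPolynomial.pderiv 0 g * MvPolynomial.X j) +
        0 ^ j * quantizeBracket c g := by
  rcases eq_or_ne j 0 with rfl | hj
  · rw [MvPolynomial.pderiv_mul, MvPolynomial.pderiv_X_self, mul_one, quantizeBracket_add,
      pow_zero, one_mul]
  · rw [MvPolynomial.pderiv_mul, MvPolynomial.pderiv_X_of_ne hj, mul_zero, add_zero, zero_pow hj,
      zero_mul, add_zero]

theorem quantizeBracket_pderiv_pderiv_mul_X (c : ℂ) (j : ℕ) (g : MvPolynomial ℕ ℚ) :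
    quantizeBracket c (MvPolynomial.pderiv 0 (MvPolynomial.pderiv 0 (g * MvPolynomial.X j))) =
      quantizeBracket c (MvPolynomial.pderiv 0 (MvPolynomial.pderiv 0 g) * MvPolynomial.X j) +
        2 * 0 ^ j * quantizeBracket c (MvPolynomial.pderiv 0 g) := by
  rcases eq_or_ne j 0 with rfl | hj
  · rw [MvPolynomial.pderiv_mul, MvPolynomial.pderiv_X_self, mul_one, map_add, quantizeBracket_add,
      quantizeBracket_pderiv_mul_X]
    ring
  · rw [MvPolynomial.pderiv_mul, MvPolynomial.pderiv_X_of_ne hj, mul_zero, add_zero,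
      quantizeBracket_pderiv_mul_X, zero_pow hj]
    ring

/-- The source of the whole anomaly: 𝔾₂ enters only for j = l = 0, where the propagator is 2(𝔾₂ +
1/24). In all other cases it is zero or modular. -/
theorem exists_quasimodular_propagator (j l : ℕ) :
    ∃ S : quasimodularForms, (S : PowerSeries ℂ) = propagator j l ∧
      anomalyDerivation S = -(0 ^ j * 0 ^ l) := by
  rcases Nat.even_or_odd (j + l) with h | h
  · rcases Nat.eq_zero_or_pos (j + l) with h0 | h0
    · obtain ⟨rfl, rfl⟩ : j = 0 ∧ l = 0 := by omega
      refine ⟨2 * (quasiG2 + algebraMap ℚ quasimodularForms (1 / 24)), ?_, ?_⟩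
      · have h1 : ((algebraMap ℚ quasimodularForms (1 / 24) : quasimodularForms) : PowerSeries ℂ) =
            PowerSeries.C (1 / 24) := by
          rw [Algebra.algebraMap_eq_smul_one]
          change (1 / 24 : ℚ) • (1 : PowerSeries ℂ) = _
          rw [rat_smul_eq_C_mul, mul_one]
          simp
        change (2 : PowerSeries ℂ) * (eisensteinG2 +
          ((algebraMap ℚ quasimodularForms (1 / 24) : quasimodularForms) : PowerSeries ℂ)) = _
        rw [h1, propagator, sigmaSeries_one, ← map_ofNat PowerSeries.C 2]
        congr 2
        norm_num
      · have h2 : (2 : quasimodularForms) = algebraMap ℚ quasimodularForms 2 :=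
          (map_ofNat (algebraMap ℚ quasimodularForms) 2).symm
        rw [Derivation.leibniz, map_add, isAnomalyDerivation_anomalyDerivation.2,
          Derivation.map_algebraMap, h2, Derivation.map_algebraMap, smul_zero, add_zero, add_zero,
          smul_eq_mul, ← map_mul]
        norm_num
    · obtain ⟨a, ha⟩ := h.two_dvd
      have hmem : propagator j l ∈ modularForms := by
        have h1 : ((-1) ^ l * Complex.I ^ (j + l) * (1 + (-1) ^ (j + l)) : ℂ) =
            (((-1) ^ l * (-1) ^ a * 2 : ℚ) : ℂ) := by
          rw [h.neg_one_pow, ha, pow_mul, Complex.I_sq]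
          push_cast
          norm_num
        rw [propagator, h1]
        exact mul_mem_modularForms (C_ratCast_mem_modularForms _)
          (sigmaSeries_mem_modularForms h.add_one (by omega))
      refine ⟨⟨_, modularSubalgebra_le hmem⟩, rfl, ?_⟩
      rw [isAnomalyDerivation_anomalyDerivation.1 _ hmem, ← pow_add, zero_pow h0.ne', neg_zero]
  · refine ⟨0, ?_, ?_⟩
    · rw [propagator, h.neg_one_pow]
      simp
    · rw [map_zero, ← pow_add, zero_pow h.pos.ne', neg_zero]

/-! ### Polynomials with quasimodular coefficients -/

/-- Evaluation at `c` of a polynomial with quasimodular coefficients, as a ring homomorphism. -/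
def evalAtHom (c : ℂ) : Polynomial quasimodularForms →+* PowerSeries ℂ :=
  Polynomial.eval₂RingHom (algebraMap quasimodularForms (PowerSeries ℂ)) (PowerSeries.C c)

theorem evalAtHom_apply (c : ℂ) (F : Polynomial quasimodularForms) :
    evalAtHom c F = evalAt c F := rfl

theorem evalAtHom_C (c : ℂ) (x : quasimodularForms) : evalAtHom c (Polynomial.C x) = x :=
  Polynomial.eval₂_C _ _

theorem evalAtHom_X (c : ℂ) : evalAtHom c Polynomial.X = PowerSeries.C c :=
  Polynomial.eval₂_X _ _

/-- Over the domain of power series, two polynomials that agree at the infinitely many constants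
coincide. -/
theorem evalAtHom_injective {F G : Polynomial quasimodularForms}
    (h : ∀ c, evalAtHom c F = evalAtHom c G) : F = G := by
  have hinj : Function.Injective (algebraMap quasimodularForms (PowerSeries ℂ)) :=
    Subtype.val_injective
  refine Polynomial.map_injective _ hinj (Polynomial.eq_of_infinite_eval_eq _ _ ?_)
  refine (Set.infinite_range_of_injective (f := fun c : ℂ => PowerSeries.C c)
    PowerSeries.C_injective).mono ?_
  rintro _ ⟨c, rfl⟩
  rw [Set.mem_ofPred_eq, Polynomial.eval_map, Polynomial.eval_map]
  exact h c

theorem evalAt_zero (F : Polynomial quasimodularForms) : evalAt 0 F = F.coeff 0 := by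
  rw [evalAt, map_zero, Polynomial.eval₂_at_zero]
  rfl

/-- `F` is the polynomial in `c` whose values are the `q`-series of `ḡ(c)`, and `G` is `-2𝔡F`. -/
structure IsBracketPolynomial (g : MvPolynomial ℕ ℚ) (F G : Polynomial quasimodularForms) :
    Prop where
  eval : ∀ c, evalAtHom c F = quantizeBracket c g
  eval_derivative : ∀ c, evalAtHom c (Polynomial.derivative F) =
    quantizeBracket c (MvPolynomial.pderiv 0 g)
  eval_derivative_derivative : ∀ c, evalAtHom c (Polynomial.derivative (Polynomial.derivative F)) =
    quantizeBracket c (MvPolynomial.pderiv 0 (MvPolynomial.pderiv 0 g))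
  eval_anomaly : ∀ c, evalAtHom c G =
    quantizeBracket c (MvPolynomial.pderiv 0 (MvPolynomial.pderiv 0 g))
  coeff_anomaly : ∀ i, G.coeff i = -2 * anomalyDerivation (F.coeff i)

theorem isBracketPolynomial_C (a : ℚ) :
    IsBracketPolynomial (MvPolynomial.C a)
      (Polynomial.C (algebraMap ℚ quasimodularForms a)) 0 where
  eval c := by
    rw [evalAtHom_C, quantizeBracket_C, Algebra.algebraMap_eq_smul_one]
    change a • (1 : PowerSeries ℂ) = _
    rw [rat_smul_eq_C_mul, mul_one]
  eval_derivative c := by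
    rw [Polynomial.derivative_C, map_zero, MvPolynomial.pderiv_C, quantizeBracket_zero]
  eval_derivative_derivative c := by
    rw [Polynomial.derivative_C, map_zero, map_zero, MvPolynomial.pderiv_C, map_zero,
      quantizeBracket_zero]
  eval_anomaly c := by
    rw [map_zero, MvPolynomial.pderiv_C, map_zero, quantizeBracket_zero]
  coeff_anomaly i := by
    rw [Polynomial.coeff_C]
    split_ifs <;> simp

theorem IsBracketPolynomial.add {g h : MvPolynomial ℕ ℚ} {F G F' G' : Polynomial quasimodularForms}
    (hg : IsBracketPolynomial g F G) (hh : IsBracketPolynomial h F' G') :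
    IsBracketPolynomial (g + h) (F + F') (G + G') where
  eval c := by rw [map_add, hg.eval, hh.eval, quantizeBracket_add]
  eval_derivative c := by
    rw [map_add, map_add, hg.eval_derivative, hh.eval_derivative, map_add, quantizeBracket_add]
  eval_derivative_derivative c := by
    rw [map_add, map_add, map_add, hg.eval_derivative_derivative, hh.eval_derivative_derivative,
      map_add, map_add, quantizeBracket_add]
  eval_anomaly c := by
    rw [map_add, hg.eval_anomaly, hh.eval_anomaly, map_add, map_add, quantizeBracket_add]
  coeff_anomaly i := by
    rw [Polynomial.coeff_add, Polynomial.coeff_add, map_add, mul_add, hg.coeff_anomaly,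
      hh.coeff_anomaly]

/-- Every clause is the Wick recursion for g u_j compared with its image under ∂/∂c, ∂²/∂c² or -2𝔡.
-/
theorem IsBracketPolynomial.mul_X {g : MvPolynomial ℕ ℚ} {F G : Polynomial quasimodularForms}
    (hg : IsBracketPolynomial g F G)
    (hd : ∀ l, ∃ F' G', IsBracketPolynomial (MvPolynomial.pderiv l g) F' G') (j : ℕ) :
    ∃ F' G', IsBracketPolynomial (g * MvPolynomial.X j) F' G' := by
  classical
  choose F₁ G₁ h₁ using hd
  choose S hS hDS using exists_quasimodular_propagator j
  set s : Finset ℕ := {0} ∪ g.vars ∪ (MvPolynomial.pderiv 0 g).vars ∪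
    (MvPolynomial.pderiv 0 (MvPolynomial.pderiv 0 g)).vars with hs
  have h0 : (0 : ℕ) ∈ s := by simp [hs]
  have hs0 : g.vars ⊆ s := fun x hx => by simp [hs, hx]
  have hs1 : (MvPolynomial.pderiv 0 g).vars ⊆ s := fun x hx => by simp [hs, hx]
  have hs2 : (MvPolynomial.pderiv 0 (MvPolynomial.pderiv 0 g)).vars ⊆ s :=
    fun x hx => by simp [hs, hx]
  have hcast : ∀ c : ℂ, PowerSeries.C (0 ^ j * c) = 0 ^ j * PowerSeries.C c := by
    intro c
    rw [map_mul, map_pow, map_zero]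
  have hcomm : ∀ l, MvPolynomial.pderiv l (MvPolynomial.pderiv 0 g) =
      MvPolynomial.pderiv 0 (MvPolynomial.pderiv l g) := fun l => pderiv_pderiv_comm l 0 g
  have hcomm2 : ∀ l, MvPolynomial.pderiv l (MvPolynomial.pderiv 0 (MvPolynomial.pderiv 0 g)) =
      MvPolynomial.pderiv 0 (MvPolynomial.pderiv 0 (MvPolynomial.pderiv l g)) := fun l => by
    rw [pderiv_pderiv_comm l 0, hcomm]
  -- The second witness is -2𝔡 of the first by the Leibniz rule; its term 2 · 0^j · 0^l comes from
  -- -2𝔡 applied to the propagator.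
  refine ⟨0 ^ j * (Polynomial.X * F) + ∑ l ∈ s, Polynomial.C (S l) * F₁ l,
    0 ^ j * (Polynomial.X * G) + ∑ l ∈ s, (2 * 0 ^ j * 0 ^ l * F₁ l + Polynomial.C (S l) * G₁ l),
    ?_, ?_, ?_, ?_, ?_⟩
  · intro c
    rw [quantizeBracket_mul_X c j g hs0, hcast]
    simp only [map_add, map_mul, map_sum, map_pow, map_zero, evalAtHom_C, evalAtHom_X, hS, hg.eval,
      (h₁ _).eval]
    ring
  · intro c
    rw [quantizeBracket_pderiv_mul_X, quantizeBracket_mul_X c j _ hs1, hcast]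
    have hj : Polynomial.derivative ((0 : Polynomial quasimodularForms) ^ j) = 0 := by
      rcases eq_or_ne j 0 with rfl | hj
      · simp
      · simp [hj]
    simp only [map_add, map_mul, map_sum, map_pow, map_zero, evalAtHom_C, evalAtHom_X, hS, hg.eval,
      Polynomial.derivative_mul, hj, Polynomial.derivative_X, Polynomial.derivative_C, zero_mul,
      zero_add, one_mul, hg.eval_derivative, (h₁ _).eval_derivative, hcomm]
    ring
  · intro c
    rw [quantizeBracket_pderiv_pderiv_mul_X, quantizeBracket_mul_X c j _ hs2, hcast]
    have hj : Polynomial.derivative ((0 : Polynomial quasimodularForms) ^ j) = 0 := by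
      rcases eq_or_ne j 0 with rfl | hj
      · simp
      · simp [hj]
    simp only [map_add, map_mul, map_sum, map_pow, map_zero, evalAtHom_C, evalAtHom_X, hS,
      Polynomial.derivative_mul, hj, Polynomial.derivative_X, Polynomial.derivative_C, zero_mul,
      zero_add, one_mul, hg.eval_derivative, hg.eval_derivative_derivative,
      (h₁ _).eval_derivative_derivative, hcomm2]
    ring
  · intro c
    rw [quantizeBracket_pderiv_pderiv_mul_X, quantizeBracket_mul_X c j _ hs2, hcast]
    have hsum : ∑ l ∈ s, 2 * 0 ^ j * 0 ^ l * quantizeBracket c (MvPolynomial.pderiv l g) =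
        2 * 0 ^ j * quantizeBracket c (MvPolynomial.pderiv 0 g) := by
      rw [Finset.sum_eq_single_of_mem 0 h0, pow_zero, mul_one]
      intro l _ hl
      rw [zero_pow hl, mul_zero, zero_mul]
    simp only [map_add, map_mul, map_sum, map_pow, map_zero, map_ofNat, evalAtHom_C, evalAtHom_X,
      hS, (h₁ _).eval, hg.eval_anomaly, (h₁ _).eval_anomaly, hcomm2, Finset.sum_add_distrib, hsum]
    ring
  · intro i
    have hX : (0 ^ j * (Polynomial.X * G)).coeff i =
        -2 * anomalyDerivation ((0 ^ j * (Polynomial.X * F)).coeff i) := by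
      rcases eq_or_ne j 0 with rfl | hj
      · rw [pow_zero, one_mul, one_mul]
        cases i with
        | zero => simp
        | succ i => rw [Polynomial.coeff_X_mul, Polynomial.coeff_X_mul, hg.coeff_anomaly]
      · simp [hj]
    rw [Polynomial.coeff_add, Polynomial.coeff_add, map_add, mul_add, hX,
      Polynomial.finsetSum_coeff, Polynomial.finsetSum_coeff, map_sum, Finset.mul_sum]
    congr 1
    refine Finset.sum_congr rfl fun l _ => ?_
    have hC : (2 * 0 ^ j * 0 ^ l : Polynomial quasimodularForms) =
        Polynomial.C (2 * 0 ^ j * 0 ^ l) := by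
      rw [map_mul, map_mul, map_pow, map_pow, map_ofNat, map_zero]
    rw [hC, Polynomial.coeff_add, Polynomial.coeff_C_mul, Polynomial.coeff_C_mul,
      Polynomial.coeff_C_mul, Derivation.leibniz, hDS, (h₁ l).coeff_anomaly, smul_eq_mul,
      smul_eq_mul]
    ring

/-- The induction is on a bound for the degree, because the recursion for t u_j needs the monomial t
together with all its partial derivatives. -/
theorem exists_isBracketPolynomial_monomial (n : ℕ) :
    ∀ (s : ℕ →₀ ℕ) (_ : s.degree ≤ n) (a : ℚ),
      ∃ F G, IsBracketPolynomial (MvPolynomial.monomial s a) F G := by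
  induction n with
  | zero =>
    intro s hs a
    have : s = 0 := (Finsupp.degree_eq_zero_iff s).1 (by omega)
    rw [this]
    exact ⟨_, _, isBracketPolynomial_C a⟩
  | succ n ih =>
    intro s hs a
    by_cases h0 : s = 0
    · rw [h0]
      exact ⟨_, _, isBracketPolynomial_C a⟩
    obtain ⟨j, hj⟩ := Finsupp.ne_iff.1 h0
    have hsj : s - Finsupp.single j 1 + Finsupp.single j 1 = s := by
      refine tsub_add_cancel_of_le ?_
      simp only [Finsupp.coe_zero, Pi.zero_apply] at hj
      simp; omega
    set t := s - Finsupp.single j 1 with ht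
    have hdeg : t.degree ≤ n := by
      rw [← hsj, map_add, Finsupp.degree_single] at hs
      omega
    have hmono : MvPolynomial.monomial s a = MvPolynomial.monomial t a * MvPolynomial.X j := by
      rw [MvPolynomial.X, MvPolynomial.monomial_mul, hsj, mul_one]
    rw [hmono]
    obtain ⟨F, G, h⟩ := ih t hdeg a
    refine h.mul_X (fun l => ?_) j
    rw [MvPolynomial.pderiv_monomial]
    exact ih _ ((Finsupp.degree_mono tsub_le_self).trans hdeg) _

theorem exists_isBracketPolynomial (g : MvPolynomial ℕ ℚ) :
    ∃ F G, IsBracketPolynomial g F G := by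
  induction g using MvPolynomial.induction_on' with
  | monomial s a => exact exists_isBracketPolynomial_monomial _ s le_rfl a
  | add p q hp hq =>
    obtain ⟨F, G, h⟩ := hp
    obtain ⟨F', G', h'⟩ := hq
    exact ⟨_, _, h.add h'⟩

end QuantumKdV

end

theorem proposition2p2 :
    -- the derivation `𝔡` exists and is unique
    (∃! D : Derivation ℚ QuantumKdV.quasimodularForms QuantumKdV.quasimodularForms,
      QuantumKdV.IsAnomalyDerivation D) ∧
    ∀ D : Derivation ℚ QuantumKdV.quasimodularForms QuantumKdV.quasimodularForms,
      QuantumKdV.IsAnomalyDerivation D → ∀ g : MvPolynomial ℕ ℚ,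
      -- the `q`-series of `ḡ(c)` is a polynomial `F` in `c` with quasimodular coefficients
      (∃ F : Polynomial QuantumKdV.quasimodularForms,
        (∀ c : ℂ, QuantumKdV.qBracket (QuantumKdV.quantize c g) = QuantumKdV.evalAt c F) ∧
        -- `-2𝔡 F = ∂²F/∂c²`, where `𝔡` acts on the coefficients
        (∀ j : ℕ, (-2) * D (F.coeff j) =
          (Polynomial.derivative (Polynomial.derivative F)).coeff j) ∧
        -- `∂²F/∂c²` is the `q`-series of the quantization of `∂²g/∂u₀²`
        (∀ c : ℂ, QuantumKdV.evalAt c (Polynomial.derivative (Polynomial.derivative F)) =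
          QuantumKdV.qBracket
            (QuantumKdV.quantize c (MvPolynomial.pderiv 0 (MvPolynomial.pderiv 0 g))))) ∧
      -- modularity at `c = 0`
      (QuantumKdV.qBracket (QuantumKdV.quantize 0 g) ∈ QuantumKdV.modularForms ↔
        QuantumKdV.qBracket
          (QuantumKdV.quantize 0 (MvPolynomial.pderiv 0 (MvPolynomial.pderiv 0 g))) = 0) := by
  refine ⟨⟨QuantumKdV.anomalyDerivation, QuantumKdV.isAnomalyDerivation_anomalyDerivation,
    fun D hD => hD.eq_anomalyDerivation⟩, fun D hD g => ?_⟩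
  obtain rfl := hD.eq_anomalyDerivation
  obtain ⟨F, G, h⟩ := QuantumKdV.exists_isBracketPolynomial g
  -- Both polynomials take the bracket of ∂²g/∂u_0² as value at every c; this is where -2𝔡 and
  -- ∂²/∂c² are identified.
  have hG : G = Polynomial.derivative (Polynomial.derivative F) :=
    QuantumKdV.evalAtHom_injective fun c => by rw [h.eval_anomaly, h.eval_derivative_derivative]
  refine ⟨⟨F, fun c => (h.eval c).symm, fun j => ?_, h.eval_derivative_derivative⟩, ?_⟩
  · rw [← h.coeff_anomaly, hG]
  · have h0 := h.eval 0
    have h2 := h.eval_anomaly 0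
    rw [QuantumKdV.evalAtHom_apply, QuantumKdV.evalAt_zero] at h0 h2
    change (F.coeff 0 : PowerSeries ℂ) = QuantumKdV.qBracket _ at h0
    change (G.coeff 0 : PowerSeries ℂ) = QuantumKdV.qBracket _ at h2
    rw [← h0, ← h2, ← QuantumKdV.anomalyDerivation_eq_zero_iff, h.coeff_anomaly,
      ZeroMemClass.coe_eq_zero]
    constructor
    · intro h1
      rw [h1, mul_zero]
    · intro h1
      refine (mul_eq_zero.1 h1).resolve_left (neg_ne_zero.2 fun h3 => ?_)
      have h4 : (2 : PowerSeries ℂ) = 0 := congrArg Subtype.val h3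
      have h5 := congrArg PowerSeries.constantCoeff h4
      rw [map_ofNat, map_zero] at h5
      exact two_ne_zero h5
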